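/- Setting. Let $\gamma\colon\mathbb R\to\mathbb R^2$ be a regular $C^3$ parameterization, with period $L>0$, of a simple closed plane curve $\Gamma=\gamma(\mathbb R)$ that is traversed exactly once over a period (that is, $\gamma$ is injective on $[0,L)$). Let $\kappa=\det(\gamma',\gamma'')/|\gamma'|^3$ be its signed curvature, $\dot\kappa=\kappa'/|\gamma'|$ the derivative of $\kappa$ with respect to arc length, $\sigma_\gamma(t)=(\kappa(t),\dot\kappa(t))$ the parameterized signature map, and $S_\Gamma=\sigma_\gamma(\mathbb R)\subset\mathbb R^2$ the signature. The curve is non-degenerate if its vertices, i.e. the points $\gamma(t)$ with $\dot\kappa(t)=0$, are isolated from one another. A point $p\in S_\Gamma$ is simple if some open set $U\ni p$ of $\mathbb R^2$ is such that $U\cap S_\Gamma$ is homeomorphic to $\mathbb R$ or to a half-open interval; otherwise $p$ is a point of self-intersection. Let $Q$ be the set of self-intersection points of $S_\Gamma$. If $Q$ is finite and non-empty, the signature quiver of $\Gamma$ has vertex set $Q$, and its edges are the connected components of $S_\Gamma\setminus Q$ (open curve segments), each directed from its beginning to its end point as traversed by $\sigma_\gamma$. Words are finite sequences of edges. Choose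 $c_0$ with $\sigma_\gamma(c_0)\in Q$ and let $c_0<c_1<\dots<c_k=c_0+L$ be all the points of $\sigma_\gamma^{-1}(Q)\cap[c_0,c_0+L]$. The word $S_1S_2\cdots S_k$, where $S_i=\sigma_\gamma\big((c_{i-1},c_i)\big)$ is an edge from $\sigma_\gamma(c_{i-1})$ to $\sigma_\gamma(c_i)$, is said to be induced by $\Gamma$. A word is periodic if it is of the form $v^n$ for some word $v$ and some $n>1$. The symmetry group $\mathrm{sym}(\Gamma)$ is the group of all $g\in SE(2)$ with $g\cdot\Gamma=\Gamma$, and $\text{sym-index}(\Gamma)$ is its cardinality. Proposition (Symmetry in terms of the signature quiver). Let $\Gamma$ be a simple closed non-degenerate curve as above whose signature has at least one, but only finitely many, points of self-intersection. If $\Gamma$ induces a word $W=w^m$ such that $w$ is not periodic, then $$\text{sym-index}(\Gamma)=m .$$ Hence $\mathrm{sym}(\Gamma)$ is the rotation group $\mathbb Z_m$: it is isomorphic to $\mathbb Z/m\mathbb Z$, and there is a point $C\in\mathbb R^2$ such that $\mathrm{sym}(\Gamma)$ consists exactly of the rotations about $C$ by the angles $2\pi k/m$, $0\le k<m$. -/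

import Mathlib

open Set

noncomputable section

/-- The Euclidean plane. -/
abbrev Plane : Type := EuclideanSpace ℝ (Fin 2)

/-! ### Symmetry groups -/

/-- The special Euclidean group of the plane: isometries whose linear part has determinant one. -/
def SE2 : Subgroup (Plane ≃ᵃⁱ[ℝ] Plane) where
  carrier := {g | LinearMap.det (g.linearIsometryEquiv.toLinearEquiv : Plane →ₗ[ℝ] Plane) = 1}
  one_mem' := by
    change LinearMap.det (LinearMap.id : Plane →ₗ[ℝ] Plane) = 1
    simp
  mul_mem' := by
    intro a b ha hb
    change LinearMap.det ((a.linearIsometryEquiv.toLinearEquiv : Plane →ₗ[ℝ] Plane) *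
      (b.linearIsometryEquiv.toLinearEquiv : Plane →ₗ[ℝ] Plane)) = 1
    rw [map_mul]
    exact (congrArg₂ (· * ·) ha hb).trans (one_mul 1)
  inv_mem' := by
    intro a ha
    have h : (a.linearIsometryEquiv.toLinearEquiv : Plane →ₗ[ℝ] Plane) *
        ((a⁻¹).linearIsometryEquiv.toLinearEquiv : Plane →ₗ[ℝ] Plane) = 1 := by
      ext1 x
      exact a.linearIsometryEquiv.apply_symm_apply x
    have h2 := congrArg LinearMap.det h
    rw [map_mul, map_one] at h2
    have h3 : LinearMap.det (a.linearIsometryEquiv.toLinearEquiv : Plane →ₗ[ℝ] Plane) = 1 := ha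
    rw [h3, one_mul] at h2
    exact h2

/-- The symmetry group of a subset `Γ` of the plane: the elements `g` of `SE(2)` with `g · Γ = Γ`. -/
def symGroup (Γ : Set Plane) : Subgroup SE2 where
  carrier := {g | (g : Plane ≃ᵃⁱ[ℝ] Plane) '' Γ = Γ}
  one_mem' := by
    change (id : Plane → Plane) '' Γ = Γ
    simp
  mul_mem' := by
    intro a b ha hb
    change (fun x => a.1 (b.1 x)) '' Γ = Γ
    rw [← Set.image_image (fun x => a.1 x) (fun x => b.1 x) Γ]
    exact (congrArg (fun s => a.1 '' s) hb).trans ha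
  inv_mem' := by
    intro a ha
    have ha' : a.1 '' Γ = Γ := ha
    change a.1.symm '' Γ = Γ
    conv_lhs => rw [← ha']
    rw [Set.image_image]
    simp

/-- The (global) symmetry index: the cardinality of the symmetry group. -/
def symIndex (Γ : Set Plane) : ℕ∞ := ENat.card (symGroup Γ)

/-- Counterclockwise rotation about the point `C` by the angle `θ`. -/
def rotationAbout (C : Plane) (θ : ℝ) (x : Plane) : Plane :=
  !₂[C 0 + Real.cos θ * (x 0 - C 0) - Real.sin θ * (x 1 - C 1),
     C 1 + Real.sin θ * (x 0 - C 0) + Real.cos θ * (x 1 - C 1)]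

/-! ### Curves, curvature, signature -/

/-- `γ` is a regular `C³` parameterization (over all of `ℝ`) of a simple closed curve, with
period `L`, the curve being traversed exactly once over a period. -/
structure IsSimpleClosed (γ : ℝ → Plane) (L : ℝ) : Prop where
  contDiff : ContDiff ℝ 3 γ
  regular : ∀ t, deriv γ t ≠ 0
  period_pos : 0 < L
  periodic : Function.Periodic γ L
  injOn : Set.InjOn γ (Set.Ico 0 L)

/-- The signed Euclidean curvature `det(γ', γ'') / |γ'|³`. -/
def curvature (γ : ℝ → Plane) (t : ℝ) : ℝ :=
  (deriv γ t 0 * deriv (deriv γ) t 1 - deriv γ t 1 * deriv (deriv γ) t 0) / ‖deriv γ t‖ ^ 3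

/-- The derivative of the curvature with respect to arc length, `dκ/ds = κ'(t) / |γ'(t)|`. -/
def curvatureDot (γ : ℝ → Plane) (t : ℝ) : ℝ :=
  deriv (curvature γ) t / ‖deriv γ t‖

/-- The parameterized signature map `t ↦ (κ, dκ/ds)`; its range is the signature. -/
def sigMap (γ : ℝ → Plane) (t : ℝ) : ℝ × ℝ :=
  (curvature γ t, curvatureDot γ t)

/-- The vertices of the curve parameterized by `γ`: the points where `dκ/ds = 0`. -/
def curveVertices (γ : ℝ → Plane) : Set Plane :=
  γ '' {t | curvatureDot γ t = 0}

/-- A curve is non-degenerate if each of its vertices is isolated, i.e. has a neighbourhood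
that contains no other vertex. -/
def IsNondegenerate (γ : ℝ → Plane) : Prop :=
  ∀ p ∈ curveVertices γ, ∃ U : Set Plane, IsOpen U ∧ U ∩ curveVertices γ = {p}

/-! ### Self-intersections and the signature quiver -/

/-- `p` is a simple point of `S`: some open neighbourhood of `p` meets `S` in a set homeomorphic
to `ℝ` or to a half-open interval. -/
def IsSimplePoint {X : Type*} [TopologicalSpace X] (S : Set X) (p : X) : Prop :=
  ∃ U : Set X, IsOpen U ∧ p ∈ U ∧
    (Nonempty (↥(U ∩ S) ≃ₜ ℝ) ∨ Nonempty (↥(U ∩ S) ≃ₜ ↥(Set.Ico (0 : ℝ) 1)))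

/-- The set of points of self-intersection of `S`. -/
def selfIntersections {X : Type*} [TopologicalSpace X] (S : Set X) : Set X :=
  {p | p ∈ S ∧ ¬ IsSimplePoint S p}

/-- The open segments of the curve `S` left after removing the points of self-intersection,
i.e. the connected components of the rest. -/
def openSegments {X : Type*} [TopologicalSpace X] (S : Set X) : Set (Set X) :=
  {E | ∃ x ∈ S \ selfIntersections S, E = connectedComponentIn (S \ selfIntersections S) x}

/-- The vertices of the quiver of the curve parameterized by `σ`: its self-intersection points. -/
def QuiverVertex (σ : ℝ → ℝ × ℝ) : Type :=
  ↥(selfIntersections (Set.range σ))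

/-- The quiver of the oriented closed curve parameterized by `σ`. The edges from `q` to `q'` are
the open segments of the curve which `σ` traverses in its direction from `q` to `q'`. -/
instance signatureQuiver (σ : ℝ → ℝ × ℝ) : Quiver (QuiverVertex σ) where
  Hom q q' := {E : Set (ℝ × ℝ) // E ∈ openSegments (Set.range σ) ∧
    ∃ a b : ℝ, a < b ∧ σ a = q.1 ∧ σ b = q'.1 ∧ σ '' Set.Ioo a b = E}

/-- Edges of the quiver, with their end points. -/
abbrev QuiverEdge (σ : ℝ → ℝ × ℝ) : Type := Quiver.Total (QuiverVertex σ)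

/-- The word `w ^ m`. -/
def wordPow {A : Type*} (w : List A) (m : ℕ) : List A := (List.replicate m w).flatten

/-- A word is periodic if it is a power `v ^ n` with `n > 1`. -/
def IsPeriodicWord {A : Type*} (w : List A) : Prop :=
  ∃ (v : List A) (n : ℕ), 1 < n ∧ w = wordPow v n

/-- The closed curve `γ` with period `L` induces the word `W` on its signature quiver: starting at
a parameter `c₀` which the signature map `σ` sends to a self-intersection point, let
`c₀ < c₁ < ⋯ < c_k = c₀ + L` be all the parameters in `[c₀, c₀ + L]` sent to self-intersection
points; then the `i`-th letter of `W` is the edge `σ((c_i, c_{i+1}))` from `σ(c_i)` to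
`σ(c_{i+1})`, for `0 ≤ i < k`. -/
def InducesWord (γ : ℝ → Plane) (L : ℝ) (W : List (QuiverEdge (sigMap γ))) : Prop :=
  ∃ c : Fin (W.length + 1) → ℝ,
    StrictMono c ∧
    c (Fin.last W.length) = c 0 + L ∧
    Set.range c =
      Set.Icc (c 0) (c 0 + L) ∩ sigMap γ ⁻¹' selfIntersections (Set.range (sigMap γ)) ∧
    ∀ i : Fin W.length,
      (W.get i).left.1 = sigMap γ (c i.castSucc) ∧
      (W.get i).right.1 = sigMap γ (c i.succ) ∧
      (W.get i).hom.1 = sigMap γ '' Set.Ioo (c i.castSucc) (c i.succ)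

end

/-!
Parameterize `Γ` by arc length. A curve is determined up to rigid motions by its curvature, so the
symmetries of the simple closed curve `Γ` correspond to the periods of the curvature, equivalently
of the signature map, modulo the length `ℓ` of `Γ`.

Near a simple point of the signature, the signature map takes the same values at any two parameters
`t`, `t'` over this point, up to a shift of the parameter: locally the signature is an arc, and a
reparameterization `ψ` of it with `κ ∘ ψ = κ` and `κ' ∘ ψ = κ'` has `ψ' = 1` wherever `κ' ≠ 0`,
that is, off a discrete set. Hence two passages of the signature map along the same edge of the
quiver differ by a shift, and the periods of the signature map are exactly the shifts coming from
the periods of the cyclic word `W`. Since `w` is not periodic, these are the multiples of `ℓ / m`.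

The symmetry belonging to the period `ℓ / m` has order `m`, so it is a rotation about some point.
-/

open Filter Topology Function

/-! ### Cyclic words -/

section Words

variable {A : Type*}

/-- The letters of the bi-infinite word `⋯www⋯`, indexed by `ℤ` so that `w` starts at `0`. It is
`none` everywhere if `w` is empty. -/
def cyclicLetter (w : List A) (i : ℤ) : Option A := w[(i % w.length).toNat]?

theorem cyclicLetter_natCast {w : List A} {i : ℕ} (hi : i < w.length) :
    cyclicLetter w i = w[i]? := by
  rw [cyclicLetter, ← Int.natCast_mod, Int.toNat_natCast, Nat.mod_eq_of_lt hi]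

theorem periodic_cyclicLetter (w : List A) : Periodic (cyclicLetter w) w.length := fun i => by
  rw [cyclicLetter, cyclicLetter, Int.add_emod_right]

theorem length_wordPow (w : List A) (m : ℕ) : (wordPow w m).length = m * w.length := by
  simp [wordPow]

theorem wordPow_getElem? (w : List A) {m i : ℕ} (hi : i < m * w.length) :
    (wordPow w m)[i]? = w[i % w.length]? := by
  induction m generalizing i with
  | zero => simp at hi
  | succ m ih =>
    have hsucc : wordPow w (m + 1) = w ++ wordPow w m := by simp [wordPow, List.replicate_succ]
    rcases lt_or_ge i w.length with hlt | hge
    · rw [hsucc, List.getElem?_append_left hlt, Nat.mod_eq_of_lt hlt]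
    · rw [hsucc, List.getElem?_append_right hge, ih (by rw [add_mul] at hi; omega),
        ← Nat.mod_eq_sub_mod hge]

theorem cyclicLetter_wordPow (w : List A) {m : ℕ} (hm : m ≠ 0) :
    cyclicLetter (wordPow w m) = cyclicLetter w := by
  rcases eq_or_ne w [] with rfl | hw
  · simp [wordPow]
  have hlen : 0 < m * w.length := Nat.mul_pos hm.pos (List.length_pos_iff.2 hw)
  ext1 i
  have hlt : i % ((m * w.length : ℕ) : ℤ) < (m * w.length : ℕ) :=
    Int.emod_lt_of_pos i (by exact_mod_cast hlen)
  have hnonneg : 0 ≤ i % ((m * w.length : ℕ) : ℤ) := Int.emod_nonneg i (by exact_mod_cast hlen.ne')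
  rw [cyclicLetter, cyclicLetter, length_wordPow, wordPow_getElem? w (by omega)]
  congr 1
  apply Int.ofNat_inj.1
  rw [Int.natCast_mod, Int.toNat_of_nonneg hnonneg,
    Int.toNat_of_nonneg (Int.emod_nonneg i (by simpa using hw)),
    Int.emod_emod_of_dvd i (by exact_mod_cast dvd_mul_left w.length m)]

theorem eq_of_cyclicLetter_eq {v w : List A} (hlen : v.length = w.length)
    (h : cyclicLetter v = cyclicLetter w) : v = w := by
  refine List.ext_getElem? fun i => ?_
  rcases lt_or_ge i v.length with hi | hi
  · rw [← cyclicLetter_natCast hi, ← cyclicLetter_natCast (hlen ▸ hi), h]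
  · rw [List.getElem?_eq_none hi, List.getElem?_eq_none (hlen ▸ hi)]

theorem cyclicLetter_take_of_periodic {w : List A} {d : ℕ} (hd : d ≠ 0) (hdw : d ≤ w.length)
    (h : Periodic (cyclicLetter w) d) : cyclicLetter (w.take d) = cyclicLetter w := by
  ext1 i
  have hlt : (i % (d : ℤ)).toNat < d := by
    have := Int.emod_lt_of_pos i (Int.natCast_pos.2 hd.pos)
    omega
  calc cyclicLetter (w.take d) i = w[(i % (d : ℤ)).toNat]? := by
        rw [cyclicLetter, List.length_take_of_le hdw, List.getElem?_take_of_lt hlt]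
    _ = cyclicLetter w (i % d) := by
        rw [← cyclicLetter_natCast (hlt.trans_le hdw),
          Int.toNat_of_nonneg (Int.emod_nonneg i (by exact_mod_cast hd))]
    _ = cyclicLetter w i := by
        rw [Int.emod_def, mul_comm]
        exact (h.int_mul (i / d)).sub_eq i

theorem periodic_gcd {B : Type*} {a : ℤ → B} {i j : ℤ} (hi : Periodic a i) (hj : Periodic a j) :
    Periodic a (Int.gcd i j) := by
  rw [Int.gcd_eq_gcd_ab, mul_comm i, mul_comm j]
  exact (hi.int_mul _).add_period (hj.int_mul _)

theorem length_dvd_of_periodic_cyclicLetter {w : List A} (hw : ¬ IsPeriodicWord w) {j : ℤ}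
    (hj : Periodic (cyclicLetter w) j) : (w.length : ℤ) ∣ j := by
  have hpos : 0 < w.length := List.length_pos_iff.2 fun h => hw ⟨[], 2, one_lt_two, h⟩
  set d := Int.gcd j w.length with hd
  obtain ⟨q, hq⟩ : d ∣ w.length := by exact_mod_cast Int.gcd_dvd_right j w.length
  have hd0 : d ≠ 0 := by rintro h; rw [h, zero_mul] at hq; omega
  have hq0 : q ≠ 0 := by rintro rfl; omega
  have hdle : d ≤ w.length := Nat.le_of_dvd hpos ⟨q, hq⟩
  have hpow : w = wordPow (w.take d) q := by
    refine eq_of_cyclicLetter_eq ?_ ?_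
    · rw [length_wordPow, List.length_take_of_le hdle, hq, mul_comm]
    · rw [cyclicLetter_wordPow _ hq0, cyclicLetter_take_of_periodic hd0 hdle
        (periodic_gcd hj (periodic_cyclicLetter w))]
  have hq1 : q = 1 := by
    by_contra hne
    exact hw ⟨_, q, by omega, hpow⟩
  rw [hq, hq1, mul_one, hd]
  exact Int.gcd_dvd_left j w.length

end Words

/-! ### Periods of a coded function -/

section Coding

variable {A X : Type*} {σ : ℝ → X} {Q : Set X} {C : ℤ → ℝ} {a : ℤ → A}

/-- A symbolic coding of `σ`: the parameters at which `σ` meets `Q` are listed increasingly as `C`,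
they leave no end of the line uncovered, and the letters `a i` and `a j` of two gaps
`[C i, C (i + 1)]` and `[C j, C (j + 1)]` agree exactly when `σ` takes the same values on both, up
to a translation of the parameter. -/
structure IsCoding (σ : ℝ → X) (Q : Set X) (C : ℤ → ℝ) (a : ℤ → A) : Prop where
  strictMono : StrictMono C
  range_eq : range C = σ ⁻¹' Q
  exists_mem_Icc : ∀ x, ∃ i, x ∈ Icc (C i) (C (i + 1))
  letter_eq_iff : ∀ i j, a i = a j ↔ C (j + 1) - C j = C (i + 1) - C i ∧
    ∀ x ∈ Icc (C i) (C (i + 1)), σ (x + (C j - C i)) = σ x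

theorem exists_apply_add_eq_of_strictMono (hC : StrictMono C) {τ : ℝ}
    (h : ∀ x, x + τ ∈ range C ↔ x ∈ range C) : ∃ j, ∀ i, C (i + j) = C i + τ := by
  choose f hf using fun i => (h (C i)).2 (mem_range_self i)
  have hmono : StrictMono f := fun i j hij => hC.lt_iff_lt.1 (by
    rw [hf, hf]
    exact add_lt_add_left (hC hij) τ)
  have hsurj : Surjective f := fun j => by
    obtain ⟨i, hi⟩ := (h (C j - τ)).1 ⟨j, (sub_add_cancel _ _).symm⟩
    exact ⟨i, hC.injective (by rw [hf, hi, sub_add_cancel])⟩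
  have hsucc : Periodic (fun i => f i - i) 1 := fun i => by
    have : f (i + 1) = f i + 1 := (hmono.orderIsoOfSurjective f hsurj).map_succ i
    simp only [this]
    ring
  refine ⟨f 0, fun i => ?_⟩
  have hi : f i - i = f 0 - 0 := by simpa using hsucc.int_mul_eq i
  rw [← hf, show i + f 0 = f i by linarith]

theorem apply_mul_of_apply_add_eq {k : ℤ} {ℓ : ℝ} (h : ∀ i, C (i + k) = C i + ℓ) (q : ℤ) :
    C (q * k) = C 0 + q * ℓ := by
  simpa using AddConstMapClass.map_zsmul_const (⟨C, h⟩ : AddConstMap ℤ ℝ k ℓ) q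

namespace IsCoding

theorem apply_add_of_periodic (hC : IsCoding σ Q C a) {j : ℤ} (hj : Periodic a j) (i : ℤ) :
    C (i + j) = C i + (C j - C 0) := by
  have hstep : Periodic (fun i => C (i + j) - C i) 1 := fun i => by
    have hgap := ((hC.letter_eq_iff i (i + j)).1 (hj i).symm).1
    simp only [add_right_comm i 1 j]
    linarith
  have hi : C (i + j) - C i = C (0 + j) - C 0 := by simpa using hstep.int_mul_eq i
  rw [zero_add] at hi
  linarith

theorem periodic_iff (hC : IsCoding σ Q C a) {τ : ℝ} :
    Periodic σ τ ↔ ∃ j, Periodic a j ∧ C j - C 0 = τ := by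
  constructor
  · intro hτ
    obtain ⟨j, hj⟩ := exists_apply_add_eq_of_strictMono hC.strictMono (τ := τ) fun x => by
      rw [hC.range_eq, mem_preimage, mem_preimage, hτ]
    refine ⟨j, fun i => ((hC.letter_eq_iff i (i + j)).2 ⟨?_, fun x _ => ?_⟩).symm, ?_⟩
    · rw [add_right_comm, hj, hj]
      ring
    · rw [hj, add_sub_cancel_left, hτ]
    · rw [← zero_add j, hj, add_sub_cancel_left]
  · rintro ⟨j, hj, rfl⟩ x
    obtain ⟨i, hi⟩ := hC.exists_mem_Icc x
    have hshift := ((hC.letter_eq_iff i (i + j)).1 (hj i).symm).2 x hi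
    rwa [hC.apply_add_of_periodic hj, add_sub_cancel_left] at hshift

theorem apply_mul_sub_of_periodic (hC : IsCoding σ Q C a) {n : ℤ} (hn : Periodic a n) (q : ℤ) :
    C (q * n) - C 0 = q * (C n - C 0) := by
  rw [apply_mul_of_apply_add_eq (hC.apply_add_of_periodic hn), add_sub_cancel_left]

theorem periodic_iff_mem_zmultiples {w : List A} (hC : IsCoding σ Q C (cyclicLetter w))
    (hw : ¬ IsPeriodicWord w) {τ : ℝ} :
    Periodic σ τ ↔ τ ∈ AddSubgroup.zmultiples (C w.length - C 0) := by
  rw [hC.periodic_iff, AddSubgroup.mem_zmultiples_iff]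
  constructor
  · rintro ⟨j, hj, rfl⟩
    obtain ⟨q, rfl⟩ := length_dvd_of_periodic_cyclicLetter hw hj
    exact ⟨q, by rw [zsmul_eq_mul, mul_comm _ q,
      hC.apply_mul_sub_of_periodic (periodic_cyclicLetter w)]⟩
  · rintro ⟨q, rfl⟩
    exact ⟨q * w.length, (periodic_cyclicLetter w).int_mul q, by rw [zsmul_eq_mul,
      hC.apply_mul_sub_of_periodic (periodic_cyclicLetter w)]⟩

end IsCoding

theorem exists_mem_Icc_of_apply_add_eq {k : ℤ} {ℓ : ℝ} (hC : StrictMono C) (hℓ : 0 < ℓ)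
    (h : ∀ i, C (i + k) = C i + ℓ) (x : ℝ) : ∃ i, x ∈ Icc (C i) (C (i + 1)) := by
  have hmul := apply_mul_of_apply_add_eq h
  obtain ⟨i, hi, hmax⟩ := Int.exists_greatest_of_bdd (P := fun i => C i ≤ x)
    (by
      refine ⟨⌈(x - C 0) / ℓ⌉ * k, fun i hi => hC.le_iff_le.1 (hi.trans ?_)⟩
      have := (div_le_iff₀ hℓ).1 (Int.le_ceil ((x - C 0) / ℓ))
      rw [hmul]
      linarith)
    (by
      refine ⟨⌊(x - C 0) / ℓ⌋ * k, ?_⟩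
      have := (le_div_iff₀ hℓ).1 (Int.floor_le ((x - C 0) / ℓ))
      rw [hmul]
      linarith)
  refine ⟨i, hi, le_of_not_ge fun hle => ?_⟩
  have := hmax _ hle
  omega

end Coding

section QuasiperiodicExtension

variable {k : ℕ} {c : Fin (k + 1) → ℝ} {L : ℝ}

/-- The extension of a finite sequence `c 0, …, c k = c 0 + L` to a sequence `C` indexed by `ℤ` with
`C (i + k) = C i + L`. -/
def quasiperiodicExtension (c : Fin (k + 1) → ℝ) (L : ℝ) (i : ℤ) : ℝ :=
  c (Fin.ofNat (k + 1) (i % k).toNat) + (i / k : ℤ) * L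

theorem quasiperiodicExtension_add_mul (hk : k ≠ 0) (hlast : c (Fin.last k) = c 0 + L)
    (j : Fin (k + 1)) (q : ℤ) : quasiperiodicExtension c L (j + q * k) = c j + q * L := by
  have hk' : (k : ℤ) ≠ 0 := by exact_mod_cast hk
  rw [quasiperiodicExtension, Int.add_mul_emod_self_right, Int.add_mul_ediv_right _ _ hk']
  induction j using Fin.lastCases with
  | last =>
    rw [Fin.val_last, Int.emod_self, Int.ediv_self hk', hlast]
    push_cast
    simp only [Fin.ofNat_zero]
    ring
  | cast j =>
    have hj : ((j.castSucc : ℕ) : ℤ) < k := by simp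
    rw [Int.emod_eq_of_lt (by simp) hj, Int.ediv_eq_zero_of_lt (by simp) hj, zero_add,
      Int.toNat_natCast, Fin.ofNat_val_eq_self]

theorem exists_eq_val_add_mul (hk : k ≠ 0) (i : ℤ) : ∃ (j : Fin k) (q : ℤ), i = j + q * k := by
  have hpos : (0 : ℤ) < k := by exact_mod_cast hk.pos
  have hlt := Int.emod_lt_of_pos i hpos
  have hnonneg := Int.emod_nonneg i hpos.ne'
  refine ⟨⟨(i % k).toNat, by omega⟩, i / k, ?_⟩
  rw [Int.toNat_of_nonneg hnonneg, Int.emod_add_ediv_mul]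

theorem quasiperiodicExtension_castSucc (hk : k ≠ 0) (hlast : c (Fin.last k) = c 0 + L)
    (j : Fin k) (q : ℤ) : quasiperiodicExtension c L (j + q * k) = c j.castSucc + q * L := by
  exact_mod_cast quasiperiodicExtension_add_mul hk hlast j.castSucc q

theorem quasiperiodicExtension_succ (hk : k ≠ 0) (hlast : c (Fin.last k) = c 0 + L)
    (j : Fin k) (q : ℤ) : quasiperiodicExtension c L (j + q * k + 1) = c j.succ + q * L := by
  rw [← quasiperiodicExtension_add_mul hk hlast, Fin.val_succ]
  push_cast
  ring_nf

theorem strictMono_quasiperiodicExtension (hk : k ≠ 0) (hlast : c (Fin.last k) = c 0 + L)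
    (hc : StrictMono c) : StrictMono (quasiperiodicExtension c L) := by
  refine strictMono_int_of_lt_succ fun i => ?_
  obtain ⟨j, q, rfl⟩ := exists_eq_val_add_mul hk i
  rw [quasiperiodicExtension_castSucc hk hlast, quasiperiodicExtension_succ hk hlast]
  exact add_lt_add_left (hc j.castSucc_lt_succ) _

theorem quasiperiodicExtension_add_length (hk : k ≠ 0) (hlast : c (Fin.last k) = c 0 + L) (i : ℤ) :
    quasiperiodicExtension c L (i + k) = quasiperiodicExtension c L i + L := by
  obtain ⟨j, q, rfl⟩ := exists_eq_val_add_mul hk i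
  rw [show (j : ℤ) + q * k + k = j + (q + 1 : ℤ) * k by ring,
    quasiperiodicExtension_castSucc hk hlast, quasiperiodicExtension_castSucc hk hlast]
  push_cast
  ring

theorem range_quasiperiodicExtension (hk : k ≠ 0) (hlast : c (Fin.last k) = c 0 + L) (hL : 0 < L)
    {Z : Set ℝ} (hZ : Periodic (· ∈ Z) L) (hrange : range c = Icc (c 0) (c 0 + L) ∩ Z) :
    range (quasiperiodicExtension c L) = Z := by
  have hmem (t : ℝ) (q : ℤ) : t + q * L ∈ Z ↔ t ∈ Z := iff_of_eq (hZ.int_mul q t)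
  ext t
  constructor
  · rintro ⟨i, rfl⟩
    obtain ⟨j, q, rfl⟩ := exists_eq_val_add_mul hk i
    rw [quasiperiodicExtension_castSucc hk hlast, hmem]
    exact (hrange ▸ mem_range_self j.castSucc).2
  · intro ht
    obtain ⟨q, hq, -⟩ := existsUnique_sub_zsmul_mem_Ico hL t (c 0)
    rw [zsmul_eq_mul] at hq
    obtain ⟨j, hj⟩ : t - q * L ∈ range c := by
      rw [hrange]
      exact ⟨Ico_subset_Icc_self hq, (hmem _ q).1 (by rwa [sub_add_cancel])⟩
    exact ⟨j + q * k, by rw [quasiperiodicExtension_add_mul hk hlast, hj, sub_add_cancel]⟩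

end QuasiperiodicExtension

/-! ### Local rigidity of a curve at its simple points -/

section RealFunctions

variable {f f' : ℝ → ℝ}

theorem image_mem_nhds_of_injOn {V : Set ℝ} {t : ℝ} (hV : V ∈ 𝓝 t) (hf : ContinuousOn f V)
    (hinj : InjOn f V) : f '' V ∈ 𝓝 (f t) := by
  obtain ⟨r, hr, hrV⟩ := Metric.nhds_basis_closedBall.mem_iff.1 hV
  rw [Real.closedBall_eq_Icc] at hrV
  refine mem_of_superset ?_ (image_mono hrV)
  have hleft : t - r ∈ Icc (t - r) (t + r) := ⟨le_rfl, by linarith⟩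
  have hmid : t ∈ Icc (t - r) (t + r) := ⟨by linarith, by linarith⟩
  have hright : t + r ∈ Icc (t - r) (t + r) := ⟨by linarith, le_rfl⟩
  have hcont := hf.mono hrV
  rcases hcont.strictMonoOn_of_injOn_Icc' (by linarith) (hinj.mono hrV) with hm | hm
  · exact mem_of_superset (Icc_mem_nhds (hm hleft hmid (by linarith))
      (hm hmid hright (by linarith))) (intermediate_value_Icc (by linarith) hcont)
  · exact mem_of_superset (Icc_mem_nhds (hm hmid hright (by linarith))
      (hm hleft hmid (by linarith))) (intermediate_value_Icc' (by linarith) hcont)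

theorem mul_pos_of_forall_hasDerivWithinAt_ne_zero {s : Set ℝ} (hs : Convex ℝ s)
    (hf : ∀ x ∈ s, HasDerivWithinAt f (f' x) s x) (hne : ∀ x ∈ s, f' x ≠ 0) {x y : ℝ}
    (hx : x ∈ s) (hy : y ∈ s) : 0 < f' x * f' y := by
  rcases hasDerivWithinAt_forall_lt_or_forall_gt_of_forall_ne hs hf hne with h | h
  · exact mul_pos_of_neg_of_neg (h x hx) (h y hy)
  · exact mul_pos (h x hx) (h y hy)

theorem mul_sub_pos_of_forall_hasDerivAt_ne_zero {s : Set ℝ} (hs : Convex ℝ s)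
    (hf : ∀ x, HasDerivAt f (f' x) x) (hne : ∀ x ∈ s, f' x ≠ 0) {a b x : ℝ} (hab : a < b)
    (hsub : Ioo a b ⊆ s) (hx : x ∈ s) : 0 < f' x * (f b - f a) := by
  obtain ⟨y, hy, hslope⟩ := exists_hasDerivAt_eq_slope f f' hab
    (fun z _ => (hf z).continuousAt.continuousWithinAt) fun z _ => hf z
  have hpos := mul_pos_of_forall_hasDerivWithinAt_ne_zero hs
    (fun z _ => (hf z).hasDerivWithinAt) hne hx (hsub hy)
  rw [eq_div_iff (sub_ne_zero.2 hab.ne')] at hslope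
  rw [← hslope, ← mul_assoc]
  exact mul_pos hpos (sub_pos.2 hab)

theorem hasDerivAt_ne_of_apply_eq {u v t : ℝ} (hf : ∀ x, HasDerivAt f (f' x) x) (huv : u < v)
    (hne : ∀ x ∈ Icc u v, x ≠ t → f' x ≠ 0) (heq : f u = f v) : f' u ≠ f' v := by
  obtain ⟨x, hx, hx0⟩ := exists_hasDerivAt_eq_zero huv
    (fun y _ => (hf y).continuousAt.continuousWithinAt) heq fun y _ => hf y
  obtain rfl : x = t := by_contra fun h => hne x (Ioo_subset_Icc_self hx) h hx0
  have hleft := mul_sub_pos_of_forall_hasDerivAt_ne_zero (convex_Ico u x) hf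
    (fun y hy => hne y ⟨hy.1, hy.2.le.trans hx.2.le⟩ hy.2.ne) hx.1 Ioo_subset_Ico_self
    (left_mem_Ico.2 hx.1)
  have hright := mul_sub_pos_of_forall_hasDerivAt_ne_zero (convex_Ioc x v) hf
    (fun y hy => hne y ⟨hx.1.le.trans hy.1.le, hy.2⟩ hy.1.ne') hx.2 Ioo_subset_Ioc_self
    (right_mem_Ioc.2 hx.2)
  intro h
  rw [← h] at hright
  have hsum : f' u * (f x - f u) + f' u * (f v - f x) = 0 := by rw [heq]; ring
  linarith

theorem exists_mem_nhds_injOn_prodMk (hf : ∀ x, HasDerivAt f (f' x) x) {t : ℝ}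
    (hiso : ∀ᶠ u in 𝓝[≠] t, f' u ≠ 0) : ∃ V ∈ 𝓝 t, InjOn (fun s => (f s, f' s)) V := by
  rw [eventually_nhdsWithin_iff, Metric.eventually_nhds_iff_ball] at hiso
  obtain ⟨r, hr, hne⟩ := hiso
  have hord : OrdConnected (Metric.ball t r) := (convex_ball t r).ordConnected
  have hlt {u v : ℝ} (hu : u ∈ Metric.ball t r) (hv : v ∈ Metric.ball t r) (huv : u < v) :
      (f u, f' u) ≠ (f v, f' v) := fun h =>
    hasDerivAt_ne_of_apply_eq hf huv (fun x hx => hne x (hord.out hu hv hx))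
      (congrArg Prod.fst h) (congrArg Prod.snd h)
  refine ⟨_, Metric.ball_mem_nhds t hr, fun u hu v hv huv => ?_⟩
  rcases lt_trichotomy u v with h | h | h
  · exact absurd huv (hlt hu hv h)
  · exact h
  · exact absurd huv.symm (hlt hv hu h)

theorem hasDerivAt_of_comp_eventuallyEq {g ψ : ℝ → ℝ} {m g' s : ℝ}
    (hf : HasStrictDerivAt f m (ψ s)) (hm : m ≠ 0) (hg : HasDerivAt g g' s)
    (hψ : ContinuousAt ψ s) (h : ∀ᶠ u in 𝓝 s, f (ψ u) = g u) :
    HasDerivAt ψ (m⁻¹ * g') s := by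
  have hinv := (hf.to_localInverse hm).hasDerivAt
  rw [h.self_of_nhds] at hinv
  refine (hinv.comp s hg).congr_of_eventuallyEq ?_
  filter_upwards [hψ.eventually (hf.hasStrictFDerivAt_equiv hm).eventually_left_inverse, h]
    with u hleft hu
  rw [comp_apply, ← hu]
  exact hleft.symm

theorem eventually_eq_add_mul_of_hasDerivAt_ne {ψ : ℝ → ℝ} {c t : ℝ}
    (hψ : ∀ᶠ s in 𝓝 t, ContinuousAt ψ s) (hd : ∀ᶠ s in 𝓝[≠] t, HasDerivAt ψ c s) :
    ∀ᶠ s in 𝓝 t, ψ s = ψ t + c * (s - t) := by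
  rw [eventually_nhdsWithin_iff] at hd
  obtain ⟨r, hr, h⟩ := Metric.eventually_nhds_iff_ball.1 (hψ.and hd)
  filter_upwards [Metric.ball_mem_nhds t hr] with s hs
  have hsub : uIcc t s ⊆ Metric.ball t r :=
    (convex_ball t r).ordConnected.uIcc_subset (Metric.mem_ball_self hr) hs
  have hint := MeasureTheory.integral_eq_of_hasDerivAt_off_countable ψ (fun _ => c)
    (countable_singleton t) (fun x hx => (h x (hsub hx)).1.continuousWithinAt)
    (fun x hx => (h x (hsub (Ioo_subset_Icc_self hx.1))).2 hx.2) intervalIntegrable_const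
  rw [intervalIntegral.integral_const, smul_eq_mul] at hint
  linarith

end RealFunctions

theorem add_le_and_le_add_of_eqOn {X : Type*} {σ : ℝ → X} {Q : Set X}
    {a b a' b' t δ : ℝ} (ha : σ a ∈ Q) (hb : σ b ∈ Q) (hQ' : ∀ x ∈ Ioo a' b', σ x ∉ Q)
    (ht : t ∈ Ioo a b) (htδ : t + δ ∈ Ioo a' b')
    (heq : EqOn σ (fun x => σ (x + δ)) (Icc a b)) : a + δ ≤ a' ∧ b' ≤ b + δ := by
  have hab : a ≤ b := (ht.1.trans ht.2).le
  constructor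
  · refine le_of_not_gt fun h => hQ' (a + δ) ⟨h, by linarith [ht.1, htδ.2]⟩ ?_
    rwa [show σ (a + δ) = σ a from (heq (left_mem_Icc.2 hab)).symm]
  · refine le_of_not_gt fun h => hQ' (b + δ) ⟨by linarith [ht.2, htδ.1], h⟩ ?_
    rwa [show σ (b + δ) = σ b from (heq (right_mem_Icc.2 hab)).symm]

section SimplePoints

variable {X : Type*} [TopologicalSpace X] {σ : ℝ → X} {t t' : ℝ}

theorem IsSimplePoint.exists_continuousOn_injOn {S : Set X} {p : X} (h : IsSimplePoint S p) :
    ∃ (U : Set X) (H : X → ℝ), IsOpen U ∧ p ∈ U ∧ ContinuousOn H (U ∩ S) ∧ InjOn H (U ∩ S) := by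
  classical
  obtain ⟨U, hU, hp, h⟩ := h
  obtain ⟨k, hk, hki⟩ : ∃ k : ↥(U ∩ S) → ℝ, Continuous k ∧ Injective k := by
    rcases h with ⟨⟨k⟩⟩ | ⟨⟨k⟩⟩
    · exact ⟨k, k.continuous, k.injective⟩
    · exact ⟨fun x => k x, continuous_subtype_val.comp k.continuous,
        Subtype.val_injective.comp k.injective⟩
  have hrestrict : (U ∩ S).domRestrict (fun x => if hx : x ∈ U ∩ S then k ⟨x, hx⟩ else 0) = k := by
    ext x
    exact dif_pos x.2
  refine ⟨U, fun x => if hx : x ∈ U ∩ S then k ⟨x, hx⟩ else 0, hU, hp, ?_, ?_⟩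
  · rwa [continuousOn_iff_continuous_domRestrict, hrestrict]
  · rwa [injOn_iff_injective, hrestrict]

theorem IsSimplePoint.eventually_mem_image (hσ : Continuous σ)
    (hp : IsSimplePoint (range σ) (σ t)) (ht : σ t = σ t') {V : Set ℝ} (hV : V ∈ 𝓝 t')
    (hinj : InjOn σ V) : ∀ᶠ s in 𝓝 t, σ s ∈ σ '' V := by
  obtain ⟨U, H, hU, hpU, hH, hHinj⟩ := hp.exists_continuousOn_injOn
  have hmaps : MapsTo σ (σ ⁻¹' U) (U ∩ range σ) := fun s hs => ⟨hs, mem_range_self s⟩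
  have hcont : ContinuousOn (H ∘ σ) (σ ⁻¹' U) := hH.comp hσ.continuousOn hmaps
  have hUt : σ ⁻¹' U ∈ 𝓝 t := hσ.continuousAt.preimage_mem_nhds (hU.mem_nhds hpU)
  have hUt' : σ ⁻¹' U ∈ 𝓝 t' := hσ.continuousAt.preimage_mem_nhds (hU.mem_nhds (ht ▸ hpU))
  have himage : (H ∘ σ) '' (V ∩ σ ⁻¹' U) ∈ 𝓝 ((H ∘ σ) t) := by
    rw [comp_apply, ht]
    exact image_mem_nhds_of_injOn (inter_mem hV hUt') (hcont.mono inter_subset_right)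
      (hHinj.comp (hinj.mono inter_subset_left) (hmaps.mono_left inter_subset_right))
  filter_upwards [hUt, (hcont.continuousAt hUt).eventually himage] with s hs ⟨x, hx, hxs⟩
  exact ⟨x, hx.1, hHinj (hmaps hx.2) (hmaps hs) hxs⟩

variable [T2Space X]

theorem exists_continuousOn_lift {Y V : Type*} [TopologicalSpace Y] [Nonempty Y]
    [TopologicalSpace V] {F : Y → X} {G : V → X} {K : Set Y} {s : Set V} (hK : IsCompact K)
    (hF : ContinuousOn F K) (hinj : InjOn F K) (hG : ContinuousOn G s)
    (h : ∀ v ∈ s, G v ∈ F '' K) :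
    ∃ ψ : V → Y, ContinuousOn ψ s ∧ ∀ v ∈ s, ψ v ∈ K ∧ F (ψ v) = G v := by
  have : CompactSpace K := isCompact_iff_compactSpace.1 hK
  have hemb : IsClosedEmbedding (K.domRestrict F) :=
    (continuousOn_iff_continuous_domRestrict.1 hF).isClosedEmbedding (injOn_iff_injective.1 hinj)
  choose! ψ hψ using h
  refine ⟨ψ, ?_, hψ⟩
  rw [continuousOn_iff_continuous_domRestrict] at hG ⊢
  have hcont : Continuous fun v : s => (⟨ψ v, (hψ v v.2).1⟩ : K) := by
    rw [hemb.isInducing.continuous_iff]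
    convert hG using 1
    ext v
    exact (hψ v v.2).2
  exact continuous_subtype_val.comp hcont

theorem IsSimplePoint.exists_lift (hσ : Continuous σ) (hp : IsSimplePoint (range σ) (σ t))
    (ht : σ t = σ t') (hinj : ∃ V ∈ 𝓝 t', InjOn σ V) :
    ∃ ψ : ℝ → ℝ, ψ t = t' ∧ ∀ᶠ s in 𝓝 t, ContinuousAt ψ s ∧ σ (ψ s) = σ s := by
  obtain ⟨V, hV, hinj⟩ := hinj
  obtain ⟨K, hK, hKV, hKc⟩ := local_compact_nhds hV
  obtain ⟨W, hW, hWo, htW⟩ := mem_nhds_iff.1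
    (hp.eventually_mem_image hσ ht hK (hinj.mono hKV))
  obtain ⟨ψ, hψ, hψK⟩ := exists_continuousOn_lift hKc hσ.continuousOn (hinj.mono hKV)
    hσ.continuousOn hW
  refine ⟨ψ, hinj (hKV (hψK t htW).1) (mem_of_mem_nhds hV) ((hψK t htW).2.trans ht), ?_⟩
  filter_upwards [hWo.mem_nhds htW] with s hs
  exact ⟨hψ.continuousAt (hWo.mem_nhds hs), (hψK s hs).2⟩

theorem IsSimplePoint.eventually_eq_shift {f f' : ℝ → ℝ} (hf : ∀ s, HasDerivAt f (f' s) s)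
    (hf' : Continuous f') (hiso : ∀ t, ∀ᶠ u in 𝓝[≠] t, f' u ≠ 0)
    (hp : IsSimplePoint (range fun s => (f s, f' s)) (f t, f' t))
    (ht : (f t, f' t) = (f t', f' t')) :
    ∀ᶠ s in 𝓝 t, (f s, f' s) = (f (s + (t' - t)), f' (s + (t' - t))) := by
  have hσ : Continuous fun s => (f s, f' s) :=
    (continuous_iff_continuousAt.2 fun s => (hf s).continuousAt).prodMk hf'
  obtain ⟨ψ, rfl, hψ⟩ := IsSimplePoint.exists_lift (σ := fun s => (f s, f' s)) hσ hp ht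
    (exists_mem_nhds_injOn_prodMk hf (hiso t'))
  -- Differentiating `f (ψ s) = f s` and cancelling `f' (ψ s) = f' s ≠ 0` gives `ψ' s = 1`.
  have hderiv : ∀ᶠ s in 𝓝[≠] t, HasDerivAt ψ 1 s := by
    filter_upwards [hiso t, eventually_nhdsWithin_of_eventually_nhds hψ.eventually_nhds]
      with s hne hs
    obtain ⟨hcont, heq⟩ := hs.self_of_nhds
    have hψs : f' (ψ s) = f' s := congrArg Prod.snd heq
    have := hasDerivAt_of_comp_eventuallyEq (hasStrictDerivAt_of_hasDerivAt_of_continuousAt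
      (Eventually.of_forall hf) hf'.continuousAt) (hψs ▸ hne) (hf s) hcont
      (hs.mono fun u hu => congrArg Prod.fst hu.2)
    rwa [hψs, inv_mul_cancel₀ hne] at this
  filter_upwards [hψ, eventually_eq_add_mul_of_hasDerivAt_ne (hψ.mono fun s hs => hs.1) hderiv]
    with s hs hlin
  rw [← hs.2, hlin, show ψ t + 1 * (s - t) = s + (ψ t - t) by ring]

theorem eqOn_of_isPreconnected_of_eventually_eq {Y : Type*} [TopologicalSpace Y] {s : Set Y}
    (hs : IsPreconnected s) {f g : Y → X} (hf : Continuous f) (hg : Continuous g)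
    (hloc : ∀ x ∈ s, f x = g x → ∀ᶠ y in 𝓝 x, f y = g y) {x₀ : Y} (hx₀ : x₀ ∈ s)
    (h₀ : f x₀ = g x₀) : EqOn f g s := by
  have hsub : s ⊆ interior {x | f x = g x} := by
    refine hs.subset_of_closure_inter_subset isOpen_interior
      ⟨x₀, hx₀, mem_interior_iff_mem_nhds.2 (hloc x₀ hx₀ h₀)⟩ ?_
    rintro x ⟨hx, hxs⟩
    have hfg : x ∈ {x | f x = g x} :=
      (isClosed_eq hf hg).closure_subset_iff.2 interior_subset hx
    exact mem_interior_iff_mem_nhds.2 (hloc x hxs hfg)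
  exact fun x hx => interior_subset (s := {x | f x = g x}) (hsub hx)

variable {Q : Set X} {a b a' b' δ : ℝ}

theorem eqOn_Icc_of_apply_eq (hσ : Continuous σ)
    (hloc : ∀ t t', σ t ∉ Q → σ t = σ t' → ∀ᶠ s in 𝓝 t, σ s = σ (s + (t' - t)))
    (hQ : ∀ x ∈ Ioo a b, σ x ∉ Q) (ht : t ∈ Ioo a b) (htδ : σ t = σ (t + δ)) :
    EqOn σ (fun x => σ (x + δ)) (Icc a b) := by
  have hshift : Continuous fun x => σ (x + δ) := hσ.comp (continuous_add_const δ)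
  rw [← closure_Ioo (ht.1.trans ht.2).ne]
  refine (eqOn_of_isPreconnected_of_eventually_eq isPreconnected_Ioo hσ hshift
    (fun x hx hxδ => ?_) ht htδ).closure hσ hshift
  simpa only [add_sub_cancel_left] using hloc x (x + δ) (hQ x hx) hxδ

theorem eq_shift_of_image_Ioo_eq (hσ : Continuous σ)
    (hloc : ∀ t t', σ t ∉ Q → σ t = σ t' → ∀ᶠ s in 𝓝 t, σ s = σ (s + (t' - t))) (hab : a < b)
    (ha : σ a ∈ Q) (hb : σ b ∈ Q) (ha' : σ a' ∈ Q) (hb' : σ b' ∈ Q)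
    (hQ : ∀ x ∈ Ioo a b, σ x ∉ Q) (hQ' : ∀ x ∈ Ioo a' b', σ x ∉ Q)
    (himage : σ '' Ioo a b = σ '' Ioo a' b') :
    b' - a' = b - a ∧ ∀ x ∈ Icc a b, σ (x + (a' - a)) = σ x := by
  obtain ⟨t, ht⟩ := nonempty_Ioo.2 hab
  obtain ⟨t', ht', htt'⟩ := himage ▸ mem_image_of_mem σ ht
  obtain ⟨δ, rfl⟩ : ∃ δ, t' = t + δ := ⟨t' - t, by ring⟩
  have heq := eqOn_Icc_of_apply_eq hσ hloc hQ ht htt'.symm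
  have heq' := eqOn_Icc_of_apply_eq (δ := -δ) hσ hloc hQ' ht' (by rwa [add_neg_cancel_right])
  obtain ⟨h₁, h₂⟩ := add_le_and_le_add_of_eqOn ha hb hQ' ht ht' heq
  obtain ⟨h₃, h₄⟩ := add_le_and_le_add_of_eqOn ha' hb' hQ ht' (by rwa [add_neg_cancel_right]) heq'
  obtain rfl : δ = a' - a := by linarith
  exact ⟨by linarith, fun x hx => (heq hx).symm⟩

end SimplePoints

/-! ### Closed curves of unit speed -/

/-- `z` parameterizes a simple closed curve of length `ℓ` in the complex plane by arc length, with
continuous unit tangent `T`. -/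
structure IsUnitSpeedClosed (z T : ℝ → ℂ) (ℓ : ℝ) : Prop where
  hasDerivAt : ∀ s, HasDerivAt z (T s) s
  continuous_tangent : Continuous T
  norm_tangent : ∀ s, ‖T s‖ = 1
  length_pos : 0 < ℓ
  eq_iff : ∀ s t, z s = z t ↔ s - t ∈ AddSubgroup.zmultiples ℓ

namespace IsUnitSpeedClosed

variable {z T : ℝ → ℂ} {κ : ℝ → ℝ} {ℓ τ : ℝ}

theorem continuous (h : IsUnitSpeedClosed z T ℓ) : Continuous z :=
  continuous_iff_continuousAt.2 fun s => (h.hasDerivAt s).continuousAt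

theorem periodic (h : IsUnitSpeedClosed z T ℓ) : Periodic z ℓ := fun s => by
  rw [h.eq_iff, add_sub_cancel_left]
  exact AddSubgroup.mem_zmultiples ℓ

theorem tangent_ne_zero (h : IsUnitSpeedClosed z T ℓ) (s : ℝ) : T s ≠ 0 :=
  norm_ne_zero_iff.1 (h.norm_tangent s ▸ one_ne_zero)

theorem conj_mul_tangent (h : IsUnitSpeedClosed z T ℓ) (s : ℝ) : starRingEnd ℂ (T s) * T s = 1 := by
  rw [Complex.conj_mul', h.norm_tangent, Complex.ofReal_one, one_pow]

theorem apply_add_half_ne (h : IsUnitSpeedClosed z T ℓ) (s : ℝ) : z (s + ℓ / 2) ≠ z s := by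
  rw [Ne, h.eq_iff, add_sub_cancel_left, AddSubgroup.mem_zmultiples_iff]
  rintro ⟨n, hn⟩
  rw [zsmul_eq_mul] at hn
  have hn' : (2 * n : ℝ) = 1 := mul_right_cancel₀ h.length_pos.ne' (by linarith)
  have : 2 * n = 1 := by exact_mod_cast hn'
  omega

theorem affine_ext (h : IsUnitSpeedClosed z T ℓ) {u v u' v' : ℂ} {s : ℝ}
    (hs : u * z s + v = u' * z s + v')
    (hs' : u * z (s + ℓ / 2) + v = u' * z (s + ℓ / 2) + v') : u = u' ∧ v = v' := by
  have hmul : (u - u') * (z (s + ℓ / 2) - z s) = 0 := by linear_combination hs' - hs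
  obtain rfl : u = u' := sub_eq_zero.1
    ((mul_eq_zero.1 hmul).resolve_right (sub_ne_zero.2 (h.apply_add_half_ne s)))
  exact ⟨rfl, add_left_cancel hs⟩

theorem periodic_curvature_of_forall_eq (h : IsUnitSpeedClosed z T ℓ)
    (hκ : ∀ s, HasDerivAt T (κ s * Complex.I * T s) s) {u v : ℂ}
    (huv : ∀ s, u * z s + v = z (s + τ)) : Periodic κ τ := by
  have htangent (s : ℝ) : T (s + τ) = u * T s := by
    have hz := ((h.hasDerivAt s).const_mul u).add_const v
    rw [funext huv] at hz
    exact ((h.hasDerivAt (s + τ)).comp_add_const s τ).unique hz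
  intro s
  have hT := (hκ s).const_mul u
  rw [← funext htangent] at hT
  have hmul := ((hκ (s + τ)).comp_add_const s τ).unique hT
  rw [mul_left_comm, ← htangent] at hmul
  have hne := h.tangent_ne_zero (s + τ)
  exact_mod_cast mul_right_cancel₀ Complex.I_ne_zero (mul_right_cancel₀ hne hmul)

theorem exists_forall_eq_of_periodic_curvature (h : IsUnitSpeedClosed z T ℓ)
    (hκ : ∀ s, HasDerivAt T (κ s * Complex.I * T s) s) (hτ : Periodic κ τ) :
    ∃ (u : Circle) (v : ℂ), ∀ s, u * z s + v = z (s + τ) := by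
  have hconst {F : ℝ → ℂ} (hF : ∀ s, HasDerivAt F 0 s) (s : ℝ) : F s = F 0 :=
    is_const_of_deriv_eq_zero (fun x => (hF x).differentiableAt) (fun x => (hF x).deriv) s 0
  set a := T (0 + τ) * starRingEnd ℂ (T 0) with ha
  have hmul : ∀ s, T (s + τ) * starRingEnd ℂ (T s) = a := by
    refine hconst (F := fun s => T (s + τ) * starRingEnd ℂ (T s)) fun s => ?_
    have hconj : HasDerivAt (fun s => starRingEnd ℂ (T s))
        (starRingEnd ℂ (κ s * Complex.I * T s)) s := (hκ s).star
    refine (((hκ (s + τ)).comp_add_const s τ).mul hconj).congr_deriv ?_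
    rw [hτ]
    simp only [map_mul, Complex.conj_I, Complex.conj_ofReal]
    ring
  have htangent (s : ℝ) : T (s + τ) = a * T s := by
    rw [← hmul s, mul_assoc, h.conj_mul_tangent, mul_one]
  have hnorm : ‖a‖ = 1 := by
    rw [ha, norm_mul, RCLike.norm_conj, h.norm_tangent, h.norm_tangent, one_mul]
  have hsub : ∀ s, z (s + τ) - a * z s = z (0 + τ) - a * z 0 :=
    hconst (F := fun s => z (s + τ) - a * z s) fun s =>
      (((h.hasDerivAt (s + τ)).comp_add_const s τ).sub ((h.hasDerivAt s).const_mul a)).congr_deriv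
        (by rw [htangent, sub_self])
  refine ⟨⟨a, mem_sphere_zero_iff_norm.2 hnorm⟩, z (0 + τ) - a * z 0, fun s => ?_⟩
  rw [← hsub s]
  exact add_sub_cancel _ _

theorem exists_continuous_lift (h : IsUnitSpeedClosed z T ℓ) {w : ℝ → ℂ} (hw : Continuous w)
    (hrange : ∀ s, w s ∈ range z) : ∃ ψ : ℝ → ℝ, Continuous ψ ∧ ∀ s, z (ψ s) = w s := by
  have : Fact (0 < ℓ) := ⟨h.length_pos⟩
  have hcont : Continuous h.periodic.lift := h.continuous.quotient_lift _
  have hinj : Injective h.periodic.lift := fun x y => by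
    induction x using QuotientAddGroup.induction_on
    induction y using QuotientAddGroup.induction_on
    rw [Periodic.lift_coe, Periodic.lift_coe, h.eq_iff]
    exact QuotientAddGroup.eq_iff_sub_mem.2
  obtain ⟨g, hg, hgw⟩ := exists_continuousOn_lift (s := univ) isCompact_univ hcont.continuousOn
    hinj.injOn hw.continuousOn fun s _ => by
      obtain ⟨x, hx⟩ := hrange s
      exact ⟨x, mem_univ _, hx⟩
  obtain ⟨x, hx⟩ := QuotientAddGroup.mk_surjective (g 0)
  obtain ⟨ψ, ⟨-, hψ⟩, -⟩ := (AddCircle.isCoveringMap_coe ℓ).existsUnique_continuousMap_lifts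
    ⟨g, continuousOn_univ.1 hg⟩ 0 x hx
  refine ⟨ψ, ψ.continuous, fun s => ?_⟩
  rw [← (hgw s (mem_univ s)).2, ← Periodic.lift_coe h.periodic]
  exact congrArg h.periodic.lift (congrFun hψ s)

theorem exists_hasDerivAt_of_comp_eq (h : IsUnitSpeedClosed z T ℓ) {w : ℝ → ℂ} {ψ : ℝ → ℝ}
    {W : ℂ} {s : ℝ} (hw : HasDerivAt w W s) (hψ : Continuous ψ) (hz : ∀ s, z (ψ s) = w s) :
    ∃ c : ℝ, HasDerivAt ψ c s ∧ W = c * T (ψ s) := by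
  -- The component of `z` along the tangent at `ψ s` is a local coordinate on the curve.
  set τ₀ := starRingEnd ℂ (T (ψ s)) with hτ₀
  have hre {F : ℝ → ℂ} {F' : ℂ} {x : ℝ} (hF : HasDerivAt F F' x) :
      HasDerivAt (fun y => (τ₀ * F y).re) (τ₀ * F').re x :=
    Complex.reCLM.hasFDerivAt.comp_hasDerivAt _ (hF.const_mul τ₀)
  have hone : (τ₀ * T (ψ s)).re = 1 := by rw [hτ₀, h.conj_mul_tangent, Complex.one_re]
  have hstrict : HasStrictDerivAt (fun y => (τ₀ * z y).re) 1 (ψ s) := hone ▸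
    hasStrictDerivAt_of_hasDerivAt_of_continuousAt (f' := fun y => (τ₀ * T y).re)
      (Eventually.of_forall fun y => hre (h.hasDerivAt y))
      (Complex.continuous_re.comp (continuous_const.mul h.continuous_tangent)).continuousAt
  have hderiv := hasDerivAt_of_comp_eventuallyEq hstrict one_ne_zero (hre hw) hψ.continuousAt
    (Eventually.of_forall fun u => by rw [hz])
  refine ⟨_, hderiv, ?_⟩
  have hcomp := (h.hasDerivAt (ψ s)).scomp s hderiv
  rw [show z ∘ ψ = w from funext hz] at hcomp
  rw [← Complex.real_smul]
  exact hw.unique hcomp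

theorem exists_eq_apply_add_mul (h : IsUnitSpeedClosed z T ℓ) {w W : ℝ → ℂ}
    (hw : ∀ s, HasDerivAt w (W s) s) (hW : ∀ s, ‖W s‖ = 1) (hrange : ∀ s, w s ∈ range z) :
    ∃ ε t : ℝ, (ε = 1 ∨ ε = -1) ∧ ∀ s, w s = z (t + ε * s) := by
  obtain ⟨ψ, hψ, hz⟩ := h.exists_continuous_lift
    (continuous_iff_continuousAt.2 fun s => (hw s).continuousAt) hrange
  choose c hc hcW using fun s => h.exists_hasDerivAt_of_comp_eq (hw s) hψ hz
  have hunit (s : ℝ) : c s = 1 ∨ c s = -1 := by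
    have := congrArg norm (hcW s)
    rw [hW, norm_mul, h.norm_tangent, mul_one, Complex.norm_real, Real.norm_eq_abs] at this
    exact eq_or_eq_neg_of_abs_eq this.symm
  have hconst (s : ℝ) : c s = c 0 := by
    have hpos := mul_pos_of_forall_hasDerivWithinAt_ne_zero convex_univ
      (fun x _ => (hc x).hasDerivWithinAt)
      (fun x _ => by rcases hunit x with hx | hx <;> rw [hx] <;> norm_num)
      (mem_univ s) (mem_univ 0)
    rcases hunit s with hs | hs <;> rcases hunit 0 with h0 | h0 <;> rw [hs, h0] at hpos ⊢ <;>
      linarith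
  have hderiv (s : ℝ) : HasDerivAt (fun s => ψ s - c 0 * s) 0 s :=
    ((hc s).fun_sub ((hasDerivAt_id' s).const_mul (c 0))).congr_deriv
      (by rw [hconst, mul_one, sub_self])
  have hlin (s : ℝ) : ψ s - c 0 * s = ψ 0 - c 0 * 0 :=
    is_const_of_deriv_eq_zero (fun x => (hderiv x).differentiableAt) (fun x => (hderiv x).deriv) s 0
  refine ⟨c 0, ψ 0, hunit 0, fun s => ?_⟩
  rw [← hz, show ψ s = ψ 0 + c 0 * s by linarith [hlin s]]

theorem exists_shift_of_mem_range (h : IsUnitSpeedClosed z T ℓ) {u : Circle} {v : ℂ}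
    (huv : ∀ s, u * z s + v ∈ range z) : ∃ τ, ∀ s, u * z s + v = z (s + τ) := by
  obtain ⟨ε, t, rfl | rfl, ht⟩ := h.exists_eq_apply_add_mul (w := fun s => u * z s + v)
    (fun s => ((h.hasDerivAt s).const_mul (u : ℂ)).add_const v)
    (fun s => by rw [norm_mul, Circle.norm_coe, h.norm_tangent, one_mul]) huv
  · exact ⟨t, fun s => by rw [ht, one_mul, add_comm]⟩
  -- A symmetry reversing the orientation of the curve fixes two of its points, so it is trivial.
  exfalso
  have hfix₁ : u * z (t / 2) + v = 1 * z (t / 2) + 0 := by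
    rw [ht, one_mul, add_zero]
    congr 1
    ring
  have hfix₂ : u * z (t / 2 + ℓ / 2) + v = 1 * z (t / 2 + ℓ / 2) + 0 := by
    rw [ht, one_mul, add_zero, ← h.periodic]
    congr 1
    ring
  obtain ⟨hu, hv⟩ := h.affine_ext hfix₁ hfix₂
  have hmid := ht (t / 2 + ℓ / 4)
  rw [hu, hv, one_mul, add_zero] at hmid
  apply h.apply_add_half_ne (t / 2 - ℓ / 4)
  convert hmid using 2 <;> ring

end IsUnitSpeedClosed

theorem periodic_prodMk_deriv_iff {f f' : ℝ → ℝ} (hf : ∀ s, HasDerivAt f (f' s) s) {τ : ℝ} :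
    Periodic (fun s => (f s, f' s)) τ ↔ Periodic f τ := by
  refine ⟨fun h s => congrArg Prod.fst (h s), fun h s => Prod.ext (h s) ?_⟩
  have hshift := (hf (s + τ)).comp_add_const s τ
  rw [funext h] at hshift
  exact hshift.unique (hf s)

/-! ### Rotations and the special Euclidean group -/

/-- The identification of the Euclidean plane with the complex plane. -/
noncomputable def planeToComplex : Plane ≃ₗᵢ[ℝ] ℂ :=
  Complex.orthonormalBasisOneI.repr.symm

theorem planeToComplex_apply (x : Plane) : planeToComplex x = x 0 + x 1 * Complex.I :=
  Complex.orthonormalBasisOneI_repr_symm_apply x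

theorem planeToComplex_re (x : Plane) : (planeToComplex x).re = x 0 := by
  simp [planeToComplex_apply]

theorem planeToComplex_im (x : Plane) : (planeToComplex x).im = x 1 := by
  simp [planeToComplex_apply]

theorem planeToComplex_rotationAbout (C : Plane) (θ : ℝ) (x : Plane) :
    planeToComplex (rotationAbout C θ x) =
      Circle.exp θ * (planeToComplex x - planeToComplex C) + planeToComplex C := by
  rw [Circle.coe_exp, Complex.exp_mul_I, ← Complex.ofReal_cos, ← Complex.ofReal_sin]
  simp only [planeToComplex_apply, rotationAbout]
  generalize Real.cos θ = c
  generalize Real.sin θ = s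
  apply Complex.ext <;> simp <;> ring

theorem exists_pow_eq_of_pow_eq_one {m : ℕ} [NeZero m] {ζ u : Circle} (hζ : IsPrimitiveRoot ζ m)
    (hu : u ^ m = 1) : ∃ k < m, ζ ^ k = u := by
  have hζ' : IsPrimitiveRoot (ζ : ℂ) m :=
    hζ.map_of_injective (f := Circle.coeHom) Circle.coe_injective
  obtain ⟨k, hk, hku⟩ := hζ'.eq_pow_of_pow_eq_one (ξ := (u : ℂ)) (by rw [← Circle.coe_pow, hu]; rfl)
  exact ⟨k, hk, Circle.coe_injective (by rw [Circle.coe_pow, hku])⟩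

theorem isPrimitiveRoot_circleExp {m : ℕ} (hm : m ≠ 0) :
    IsPrimitiveRoot (Circle.exp (2 * Real.pi / m)) m := by
  refine IsPrimitiveRoot.of_map_of_injective (f := Circle.coeHom) ?_ Circle.coe_injective
  convert Complex.isPrimitiveRoot_exp m hm using 1
  change ((Circle.exp (2 * Real.pi / m) : Circle) : ℂ) = _
  rw [Circle.coe_exp]
  congr 1
  push_cast
  ring

theorem mem_zpowers_iff_exists_eq_circleExp {m : ℕ} (hm : m ≠ 0) {ζ u : Circle}
    (hζ : orderOf ζ = m) :
    u ∈ Subgroup.zpowers ζ ↔ ∃ k : ℕ, k < m ∧ u = Circle.exp (2 * Real.pi * k / m) := by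
  have : NeZero m := ⟨hm⟩
  have hroot : IsPrimitiveRoot ζ m := hζ ▸ IsPrimitiveRoot.orderOf ζ
  have hexp (k : ℕ) : Circle.exp (2 * Real.pi * k / m) = Circle.exp (2 * Real.pi / m) ^ k := by
    rw [← Circle.exp_nsmul, nsmul_eq_mul]
    congr 1
    ring
  simp only [hexp]
  constructor
  · rintro ⟨n, rfl⟩
    have hpow : (ζ ^ n) ^ m = 1 := by
      rw [← zpow_natCast, zpow_comm, zpow_natCast, hroot.pow_eq_one, one_zpow]
    obtain ⟨k, hk, hkn⟩ := exists_pow_eq_of_pow_eq_one (isPrimitiveRoot_circleExp hm) hpow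
    exact ⟨k, hk, hkn.symm⟩
  · rintro ⟨k, -, rfl⟩
    obtain ⟨n, -, hn⟩ := exists_pow_eq_of_pow_eq_one hroot
      (u := Circle.exp (2 * Real.pi / m) ^ k)
      (by rw [pow_right_comm, (isPrimitiveRoot_circleExp hm).pow_eq_one, one_pow])
    exact hn ▸ Subgroup.npow_mem_zpowers ζ n

theorem enatCard_zpowers {G : Type*} [Group G] {g : G} (hg : orderOf g ≠ 0) :
    ENat.card (Subgroup.zpowers g) = orderOf g := by
  have : Finite (Subgroup.zpowers g) := Nat.finite_of_card_ne_zero (by rwa [Nat.card_zpowers])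
  rw [ENat.card_eq_coe_natCard, Nat.card_zpowers]

namespace SE2

theorem ext {g g' : SE2} (h : ∀ x, planeToComplex (g.1 x) = planeToComplex (g'.1 x)) : g = g' :=
  Subtype.ext (AffineIsometryEquiv.ext fun x => planeToComplex.injective (h x))

/-- The orientation-preserving rigid motion `x ↦ u x + v` of the plane, in the complex coordinate
given by `planeToComplex`. -/
noncomputable def motion (u : Circle) (v : ℂ) : SE2 :=
  ⟨(planeToComplex.trans ((rotation u).trans planeToComplex.symm)).toAffineIsometryEquiv.trans
      (AffineIsometryEquiv.constVAdd ℝ Plane (planeToComplex.symm v)),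
    (LinearMap.det_conj ((rotation u).toLinearEquiv : ℂ →ₗ[ℝ] ℂ)
      planeToComplex.symm.toLinearEquiv).trans (det_rotation u)⟩

theorem planeToComplex_motion (u : Circle) (v : ℂ) (x : Plane) :
    planeToComplex ((motion u v).1 x) = u * planeToComplex x + v := by
  change planeToComplex (planeToComplex.symm v +
    planeToComplex.symm (rotation u (planeToComplex x))) = _
  rw [map_add, LinearIsometryEquiv.apply_symm_apply, LinearIsometryEquiv.apply_symm_apply,
    rotation_apply, add_comm]

theorem exists_eq_motion (g : SE2) : ∃ u v, g = motion u v := by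
  set A := g.1.linearIsometryEquiv
  set f : ℂ ≃ₗᵢ[ℝ] ℂ := planeToComplex.symm.trans (A.trans planeToComplex) with hf
  have hdet : LinearMap.det (f.toLinearEquiv : ℂ →ₗ[ℝ] ℂ) = 1 :=
    (LinearMap.det_conj _ planeToComplex.toLinearEquiv).trans g.2
  obtain ⟨u, hu | hu⟩ := linear_isometry_complex f
  · refine ⟨u, planeToComplex (g.1 0), ext fun x => ?_⟩
    have hA : g.1 x = A x + g.1 0 := by simpa using g.1.map_vadd 0 x
    rw [planeToComplex_motion, hA, map_add, ← rotation_apply, ← hu]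
    simp only [hf, LinearIsometryEquiv.trans_apply, LinearIsometryEquiv.symm_apply_apply]
  · have hconj : LinearMap.det (f.toLinearEquiv : ℂ →ₗ[ℝ] ℂ) =
        LinearMap.det ((rotation u).toLinearEquiv : ℂ →ₗ[ℝ] ℂ) *
          LinearMap.det (Complex.conjAe.toLinearEquiv : ℂ →ₗ[ℝ] ℂ) := by
      rw [hu, ← map_mul]
      rfl
    rw [hdet, det_rotation, Complex.det_conjAe] at hconj
    norm_num at hconj

theorem motion_mul_motion (u u' : Circle) (v v' : ℂ) :
    motion u v * motion u' v' = motion (u * u') (u * v' + v) := ext fun x => by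
  change planeToComplex ((motion u v).1 ((motion u' v').1 x)) = _
  simp only [planeToComplex_motion, Circle.coe_mul]
  ring

theorem motion_injective {u u' : Circle} {v v' : ℂ} (h : motion u v = motion u' v') :
    u = u' ∧ v = v' := by
  have happly (x : ℂ) : u * x + v = u' * x + v' := by
    have := congrArg (fun g : SE2 => planeToComplex (g.1 (planeToComplex.symm x))) h
    simpa only [planeToComplex_motion, LinearIsometryEquiv.apply_symm_apply] using this
  have hv : v = v' := by simpa using happly 0
  exact ⟨Circle.coe_injective (by simpa [hv] using happly 1), hv⟩

/-- The group of rotations about the point `C`, parameterized by the unit circle. -/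
noncomputable def rotationHom (C : ℂ) : Circle →* SE2 where
  toFun u := motion u (C - u * C)
  map_one' := ext fun x => by
    rw [planeToComplex_motion, Circle.coe_one, one_mul, one_mul, sub_self, add_zero]
    rfl
  map_mul' u u' := by
    rw [motion_mul_motion, Circle.coe_mul]
    congr 1
    ring

theorem rotationHom_injective (C : ℂ) : Injective (rotationHom C) :=
  fun _ _ h => (motion_injective h).1

theorem eq_rotationHom_circleExp_iff {g : SE2} {C : ℂ} {θ : ℝ} :
    g = rotationHom C (Circle.exp θ) ↔
      ∀ x, g.1 x = rotationAbout (planeToComplex.symm C) θ x := by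
  have happly (x : Plane) : planeToComplex ((rotationHom C (Circle.exp θ)).1 x) =
      planeToComplex (rotationAbout (planeToComplex.symm C) θ x) := by
    rw [planeToComplex_rotationAbout, LinearIsometryEquiv.apply_symm_apply]
    refine (planeToComplex_motion _ _ _).trans ?_
    ring
  refine ⟨fun h x => planeToComplex.injective (h ▸ happly x), fun h => ext fun x => ?_⟩
  rw [h, happly]

theorem exists_eq_rotationHom_of_pow_eq_one {g : SE2} {m : ℕ} (hm : m ≠ 0) (hg : g ^ m = 1) :
    ∃ C u, g = rotationHom C u := by
  obtain ⟨u, v, rfl⟩ := exists_eq_motion g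
  obtain rfl | hu := eq_or_ne u 1
  · have hpow (k : ℕ) : motion 1 v ^ k = motion 1 (k * v) := by
      induction k with
      | zero =>
        rw [pow_zero, Nat.cast_zero, zero_mul, ← map_one (rotationHom 0)]
        simp [rotationHom]
      | succ k ih =>
        rw [pow_succ, ih, motion_mul_motion, Circle.coe_one, one_mul, one_mul]
        push_cast
        ring_nf
    have hone : motion 1 0 = 1 := by simpa using hpow 0 |>.symm
    rw [hpow, ← hone] at hg
    have hv : v = 0 := (mul_eq_zero.1 (motion_injective hg).2).resolve_left (Nat.cast_ne_zero.2 hm)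
    exact ⟨0, 1, by rw [hv, hone, map_one]⟩
  · have hu' : (1 : ℂ) - u ≠ 0 := sub_ne_zero.2 fun h => hu (Circle.coe_injective h.symm)
    refine ⟨v / (1 - u), u, congrArg (motion u) ?_⟩
    field_simp

theorem mem_zpowers_iff_exists_rotationAbout {m : ℕ} (hm : m ≠ 0) {ρ : SE2}
    (hρ : orderOf ρ = m) : ∃ C : Plane, ∀ g : SE2, g ∈ Subgroup.zpowers ρ ↔
      ∃ k : ℕ, k < m ∧
        ∀ x : Plane, g.1 x = rotationAbout C (2 * Real.pi * (k : ℝ) / (m : ℝ)) x := by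
  obtain ⟨C, ζ, rfl⟩ := exists_eq_rotationHom_of_pow_eq_one hm (hρ ▸ pow_orderOf_eq_one ρ)
  refine ⟨planeToComplex.symm C, fun g => ?_⟩
  rw [orderOf_injective _ (rotationHom_injective C)] at hρ
  simp only [← eq_rotationHom_circleExp_iff]
  rw [← MonoidHom.map_zpowers, Subgroup.mem_map]
  simp only [mem_zpowers_iff_exists_eq_circleExp hm hρ]
  constructor
  · rintro ⟨_, ⟨k, hk, rfl⟩, rfl⟩
    exact ⟨k, hk, rfl⟩
  · rintro ⟨k, hk, rfl⟩
    exact ⟨_, ⟨k, hk, rfl⟩, rfl⟩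

theorem zpow_apply_eq {ρ : SE2} {c : ℝ → Plane} {P : ℝ} (hρ : ∀ s, ρ.1 (c s) = c (s + P))
    (k : ℤ) : ∀ s, (ρ ^ k).1 (c s) = c (s + k * P) := by
  induction k with
  | zero => intro s; rw [Int.cast_zero, zero_mul, add_zero]; rfl
  | succ k ih =>
    intro s
    rw [zpow_add_one, show s + ((k + 1 : ℤ) : ℝ) * P = s + P + (k : ℤ) * P by push_cast; ring,
      ← ih, ← hρ]
    rfl
  | pred k ih =>
    intro s
    have hinv : (ρ⁻¹).1 (c s) = c (s - P) := by
      rw [← sub_add_cancel s P, ← hρ, add_sub_cancel_right]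
      exact ρ.1.symm_apply_apply _
    rw [zpow_sub_one, show s + ((-k - 1 : ℤ) : ℝ) * P = s - P + (-k : ℤ) * P by push_cast; ring,
      ← ih, ← hinv]
    rfl

end SE2

theorem natCast_mul_mem_zmultiples_iff {P : ℝ} (hP : P ≠ 0) {k m : ℕ} :
    (k * P : ℝ) ∈ AddSubgroup.zmultiples (m * P : ℝ) ↔ m ∣ k := by
  rw [AddSubgroup.mem_zmultiples_iff, ← Int.natCast_dvd_natCast]
  refine exists_congr fun n => ?_
  rw [zsmul_eq_mul, ← mul_assoc, mul_left_inj' hP, mul_comm (n : ℝ), eq_comm]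
  norm_cast

namespace IsUnitSpeedClosed

variable {c : ℝ → Plane} {T : ℝ → ℂ} {κ : ℝ → ℝ} {ℓ : ℝ}

theorem mem_symGroup_iff (h : IsUnitSpeedClosed (planeToComplex ∘ c) T ℓ) {g : SE2} :
    g ∈ symGroup (range c) ↔ ∃ τ, ∀ s, g.1 (c s) = c (s + τ) := by
  constructor
  · intro hg
    obtain ⟨u, v, rfl⟩ := SE2.exists_eq_motion g
    obtain ⟨τ, hτ⟩ := h.exists_shift_of_mem_range (u := u) (v := v) fun s => by
      obtain ⟨t, ht⟩ : (SE2.motion u v).1 (c s) ∈ range c :=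
        (show _ '' range c = range c from hg) ▸ mem_image_of_mem _ (mem_range_self s)
      exact ⟨t, by rw [comp_apply, ht, SE2.planeToComplex_motion, comp_apply]⟩
    exact ⟨τ, fun s => planeToComplex.injective (by rw [SE2.planeToComplex_motion]; exact hτ s)⟩
  · rintro ⟨τ, hτ⟩
    change g.1 '' range c = range c
    rw [← range_comp, show g.1 ∘ c = c ∘ (· + τ) from funext hτ,
      (add_right_surjective τ).range_comp]

theorem motion_ext (h : IsUnitSpeedClosed (planeToComplex ∘ c) T ℓ) {g g' : SE2}
    (hg : ∀ s, g.1 (c s) = g'.1 (c s)) : g = g' := by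
  obtain ⟨u, v, rfl⟩ := SE2.exists_eq_motion g
  obtain ⟨u', v', rfl⟩ := SE2.exists_eq_motion g'
  have happly (s : ℝ) : u * (planeToComplex ∘ c) s + v = u' * (planeToComplex ∘ c) s + v' := by
    simpa only [SE2.planeToComplex_motion] using! congrArg planeToComplex (hg s)
  obtain ⟨hu, rfl⟩ := h.affine_ext (happly 0) (happly _)
  rw [Circle.coe_injective hu]

theorem motion_eq_one_iff (h : IsUnitSpeedClosed (planeToComplex ∘ c) T ℓ) {g : SE2} {τ : ℝ}
    (hg : ∀ s, g.1 (c s) = c (s + τ)) : g = 1 ↔ τ ∈ AddSubgroup.zmultiples ℓ := by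
  have hshift (s : ℝ) : c (s + τ) = c s ↔ τ ∈ AddSubgroup.zmultiples ℓ := by
    rw [← planeToComplex.injective.eq_iff]
    exact (h.eq_iff (s + τ) s).trans (by rw [add_sub_cancel_left])
  refine ⟨fun h1 => (hshift 0).1 ?_, fun hτ => h.motion_ext fun s => ?_⟩
  · rw [← hg, h1]
    rfl
  · rw [hg, (hshift s).2 hτ]
    rfl

theorem periodic_curvature_iff_exists_motion (h : IsUnitSpeedClosed (planeToComplex ∘ c) T ℓ)
    (hκ : ∀ s, HasDerivAt T (κ s * Complex.I * T s) s) {τ : ℝ} :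
    Periodic κ τ ↔ ∃ g : SE2, ∀ s, g.1 (c s) = c (s + τ) := by
  constructor
  · intro hτ
    obtain ⟨u, v, huv⟩ := h.exists_forall_eq_of_periodic_curvature hκ hτ
    exact ⟨SE2.motion u v, fun s =>
      planeToComplex.injective ((SE2.planeToComplex_motion u v (c s)).trans (huv s))⟩
  · rintro ⟨g, hg⟩
    obtain ⟨u, v, rfl⟩ := SE2.exists_eq_motion g
    exact h.periodic_curvature_of_forall_eq hκ fun s =>
      (SE2.planeToComplex_motion u v (c s)).symm.trans (congrArg planeToComplex (hg s))

theorem exists_symGroup_eq_zpowers (h : IsUnitSpeedClosed (planeToComplex ∘ c) T ℓ)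
    (hκ : ∀ s, HasDerivAt T (κ s * Complex.I * T s) s) {P : ℝ} {m : ℕ} (hP : m * P = ℓ)
    (hperiods : ∀ τ, Periodic κ τ ↔ τ ∈ AddSubgroup.zmultiples P) :
    ∃ ρ : SE2, orderOf ρ = m ∧ symGroup (range c) = Subgroup.zpowers ρ := by
  obtain ⟨ρ, hρ⟩ := (h.periodic_curvature_iff_exists_motion hκ).1
    ((hperiods P).2 (AddSubgroup.mem_zmultiples P))
  have hP0 : P ≠ 0 := by
    rintro rfl
    exact h.length_pos.ne (by rw [← hP, mul_zero])
  have happly (k : ℤ) (s : ℝ) : (ρ ^ k).1 (c s) = c (s + k * P) := SE2.zpow_apply_eq hρ k s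
  refine ⟨ρ, ?_, ?_⟩
  · have hpow (k : ℕ) : ρ ^ k = 1 ↔ m ∣ k := by
      rw [← zpow_natCast, h.motion_eq_one_iff (happly k), Int.cast_natCast, ← hP,
        natCast_mul_mem_zmultiples_iff hP0]
    exact Nat.dvd_antisymm (orderOf_dvd_of_pow_eq_one ((hpow m).2 dvd_rfl))
      ((hpow _).1 (pow_orderOf_eq_one ρ))
  ext g
  rw [h.mem_symGroup_iff, Subgroup.mem_zpowers_iff]
  constructor
  · rintro ⟨τ, hτ⟩
    obtain ⟨k, rfl⟩ := AddSubgroup.mem_zmultiples_iff.1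
      ((hperiods τ).1 ((h.periodic_curvature_iff_exists_motion hκ).2 ⟨g, hτ⟩))
    exact ⟨k, h.motion_ext fun s => by rw [happly, hτ, zsmul_eq_mul]⟩
  · rintro ⟨k, rfl⟩
    exact ⟨k * P, happly k⟩

end IsUnitSpeedClosed

/-! ### Arc length -/

theorem exists_orderIso_hasDerivAt_of_periodic {v : ℝ → ℝ} {L : ℝ} (hv : Continuous v)
    (hpos : ∀ t, 0 < v t) (hL : 0 < L) (hper : Periodic v L) :
    ∃ (S : ℝ ≃o ℝ) (ℓ : ℝ), 0 < ℓ ∧ (∀ t, HasDerivAt S (v t) t) ∧ ∀ t, S (t + L) = S t + ℓ := by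
  have hint (a b : ℝ) : IntervalIntegrable v MeasureTheory.volume a b := hv.intervalIntegrable a b
  have hderiv (t : ℝ) : HasDerivAt (fun t => ∫ x in (0 : ℝ)..t, v x) (v t) t :=
    (hv.integral_hasStrictDerivAt 0 t).hasDerivAt
  have hmono : StrictMono fun t => ∫ x in (0 : ℝ)..t, v x :=
    strictMono_of_deriv_pos fun t => (hderiv t).deriv ▸ hpos t
  have hsurj : Surjective fun t => ∫ x in (0 : ℝ)..t, v x :=
    (continuous_iff_continuousAt.2 fun t => (hderiv t).continuousAt).surjective
      (hper.tendsto_atTop_intervalIntegral_of_pos' (hint 0 L) hpos hL)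
      (hper.tendsto_atBot_intervalIntegral_of_pos' (hint 0 L) hpos hL)
  exact ⟨hmono.orderIsoOfSurjective _ hsurj, ∫ x in (0 : ℝ)..0 + L, v x,
    intervalIntegral.intervalIntegral_pos_of_pos (hint _ _) hpos (by rwa [zero_add]), hderiv,
    fun t => hper.intervalIntegral_add_eq_add 0 t hint⟩

theorem periodic_deriv {E : Type*} [NormedAddCommGroup E] [NormedSpace ℝ E] {f : ℝ → E} {c : ℝ}
    (hf : Periodic f c) : Periodic (deriv f) c :=
  fun t => (deriv_comp_add_const f c t).symm.trans (by rw [funext hf])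

theorem hasDerivAt_inv_norm_smul {g : ℝ → ℂ} {g' : ℂ} {t : ℝ} (hg : HasDerivAt g g' t)
    (h0 : g t ≠ 0) :
    HasDerivAt (fun t => ‖g t‖⁻¹ • g t)
      ((((g t).re * g'.im - (g t).im * g'.re) / ‖g t‖ ^ 2 : ℝ) * Complex.I * (‖g t‖⁻¹ • g t))
      t := by
  have hpos : 0 < ‖g t‖ := norm_pos_iff.2 h0
  have hnorm : HasDerivAt (fun t => ‖g t‖) (inner ℝ (g t) g' / ‖g t‖) t := by
    have hsqrt := hg.norm_sq.sqrt (pow_ne_zero 2 hpos.ne')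
    simp only [Real.sqrt_sq (norm_nonneg _)] at hsqrt
    exact hsqrt.congr_deriv (mul_div_mul_left _ _ two_ne_zero)
  -- This is `conj (g t) * g' = ⟪g t, g'⟫ + det (g t, g') * I`, multiplied by `g t`.
  have hmul : (‖g t‖ : ℂ) ^ 2 * g' =
      ((inner ℝ (g t) g' : ℝ) + ((g t).re * g'.im - (g t).im * g'.re : ℝ) * Complex.I) * g t := by
    rw [← Complex.conj_mul', Complex.inner]
    apply Complex.ext <;> simp <;> ring
  refine ((hnorm.fun_inv hpos.ne').smul hg).congr_deriv ?_
  have hne : (‖g t‖ : ℂ) ≠ 0 := Complex.ofReal_ne_zero.2 hpos.ne'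
  simp only [Complex.real_smul]
  push_cast at hmul ⊢
  field_simp
  linear_combination hmul

/-- `R` expresses the parameter of the curve `γ`, of period `L`, in terms of arc length; `ℓ` is the
arc length of one period. -/
structure IsArcLengthReparam (γ : ℝ → Plane) (L : ℝ) (R : ℝ ≃o ℝ) (ℓ : ℝ) : Prop where
  length_pos : 0 < ℓ
  hasDerivAt : ∀ s, HasDerivAt R ‖deriv γ (R s)‖⁻¹ s
  apply_add_length : ∀ s, R (s + ℓ) = R s + L

/-- The unit tangent vector of the curve `γ`, as a complex number. -/
noncomputable def unitTangent (γ : ℝ → Plane) (t : ℝ) : ℂ :=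
  ‖planeToComplex (deriv γ t)‖⁻¹ • planeToComplex (deriv γ t)

namespace IsSimpleClosed

variable {γ : ℝ → Plane} {L : ℝ}

theorem hasDerivAt (h : IsSimpleClosed γ L) (t : ℝ) : HasDerivAt γ (deriv γ t) t :=
  (h.contDiff.differentiable (by norm_num) t).hasDerivAt

theorem contDiff_deriv (h : IsSimpleClosed γ L) : ContDiff ℝ 2 (deriv γ) :=
  (contDiff_succ_iff_deriv.1 (h.contDiff.of_le (by norm_num : (2 : WithTop ℕ∞) + 1 ≤ 3))).2.2

theorem contDiff_curvature (h : IsSimpleClosed γ L) : ContDiff ℝ 1 (curvature γ) := by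
  have hd : ContDiff ℝ 1 (deriv γ) := h.contDiff_deriv.of_le (by norm_num)
  have hdd : ContDiff ℝ 1 (deriv (deriv γ)) := (contDiff_succ_iff_deriv.1
    (h.contDiff_deriv.of_le (by norm_num : (1 : WithTop ℕ∞) + 1 ≤ 2))).2.2
  have hcoord (i : Fin 2) : ContDiff ℝ 1 fun t => deriv γ t i := contDiff_euclidean.1 hd i
  have hcoord' (i : Fin 2) : ContDiff ℝ 1 fun t => deriv (deriv γ) t i := contDiff_euclidean.1 hdd i
  exact (((hcoord 0).mul (hcoord' 1)).sub ((hcoord 1).mul (hcoord' 0))).div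
    ((hd.norm ℝ h.regular).pow 3) fun t => pow_ne_zero 3 (norm_ne_zero_iff.2 (h.regular t))

theorem continuous_curvatureDot (h : IsSimpleClosed γ L) : Continuous (curvatureDot γ) :=
  (h.contDiff_curvature.continuous_deriv le_rfl).div h.contDiff_deriv.continuous.norm
    fun t => norm_ne_zero_iff.2 (h.regular t)

theorem apply_eq_apply_iff (h : IsSimpleClosed γ L) {s t : ℝ} :
    γ s = γ t ↔ s - t ∈ AddSubgroup.zmultiples L := by
  constructor
  · intro hst
    have hmod (x : ℝ) : γ (toIcoMod h.period_pos 0 x) = γ x := h.periodic.sub_zsmul_eq _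
    obtain ⟨n, hn⟩ := toIcoMod_eq_toIcoMod h.period_pos |>.1 <| h.injOn
      (toIcoMod_mem_Ico' h.period_pos t) (toIcoMod_mem_Ico' h.period_pos s)
      (by rw [hmod, hmod, hst])
    exact ⟨n, hn.symm⟩
  · rintro ⟨n, hn⟩
    rw [← sub_add_cancel s t, ← hn, add_comm]
    exact h.periodic.zsmul n t

theorem periodic_norm_deriv (h : IsSimpleClosed γ L) : Periodic (fun t => ‖deriv γ t‖) L :=
  (periodic_deriv h.periodic).comp norm

theorem periodic_sigMap (h : IsSimpleClosed γ L) : Periodic (sigMap γ) L := by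
  have hd := periodic_deriv h.periodic
  have hκ : Periodic (curvature γ) L := fun t => by
    simp only [curvature, hd t, periodic_deriv hd t]
  exact fun t => by simp only [sigMap, curvatureDot, hκ t, periodic_deriv hκ t, hd t]

theorem exists_isArcLengthReparam (h : IsSimpleClosed γ L) :
    ∃ R ℓ, IsArcLengthReparam γ L R ℓ := by
  have hpos (t : ℝ) : 0 < ‖deriv γ t‖ := norm_pos_iff.2 (h.regular t)
  obtain ⟨S, ℓ, hℓ, hS, hSL⟩ := exists_orderIso_hasDerivAt_of_periodic
    h.contDiff_deriv.continuous.norm hpos h.period_pos h.periodic_norm_deriv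
  refine ⟨S.symm, ℓ, hℓ, fun s => ?_, fun s => ?_⟩
  · exact HasDerivAt.of_local_left_inverse S.symm.continuous.continuousAt (hS _) (hpos _).ne'
      (Eventually.of_forall S.apply_symm_apply)
  · rw [S.symm_apply_eq, hSL, S.apply_symm_apply]

theorem eventually_curvatureDot_ne_zero (h : IsSimpleClosed γ L) (hnd : IsNondegenerate γ)
    (t : ℝ) : ∀ᶠ u in 𝓝[≠] t, curvatureDot γ u ≠ 0 := by
  by_cases h0 : curvatureDot γ t = 0
  · obtain ⟨U, hU, hUt⟩ := hnd (γ t) ⟨t, h0, rfl⟩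
    have hmem : γ t ∈ U := (hUt ▸ mem_singleton (γ t) : γ t ∈ U ∩ curveVertices γ).1
    filter_upwards [(h.hasDerivAt t).eventually_ne (h.regular t) (c := γ t),
      nhdsWithin_le_nhds ((h.hasDerivAt t).continuousAt (hU.mem_nhds hmem))] with u hne hu hzero
    exact hne (hUt.subset ⟨hu, u, hzero, rfl⟩)
  · exact nhdsWithin_le_nhds (h.continuous_curvatureDot.continuousAt.eventually_ne h0)

end IsSimpleClosed

namespace IsArcLengthReparam

variable {γ : ℝ → Plane} {L ℓ : ℝ} {R : ℝ ≃o ℝ}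

theorem sub_mem_zmultiples_iff (hR : IsArcLengthReparam γ L R ℓ) {s t : ℝ} :
    R s - R t ∈ AddSubgroup.zmultiples L ↔ s - t ∈ AddSubgroup.zmultiples ℓ := by
  refine exists_congr fun n => ?_
  have hn : R (t + n • ℓ) = R t + n • L :=
    AddConstMapClass.map_add_zsmul (⟨R, hR.apply_add_length⟩ : AddConstMap ℝ ℝ ℓ L) t n
  rw [eq_sub_iff_add_eq', ← hn, R.apply_eq_iff_eq, ← eq_sub_iff_add_eq']

theorem isUnitSpeedClosed (hR : IsArcLengthReparam γ L R ℓ) (h : IsSimpleClosed γ L) :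
    IsUnitSpeedClosed (planeToComplex ∘ γ ∘ R) (unitTangent γ ∘ R) ℓ where
  hasDerivAt s := by
    have hz := planeToComplex.toContinuousLinearEquiv.hasFDerivAt.comp_hasDerivAt (R s)
      (h.hasDerivAt (R s))
    refine (hz.scomp s (hR.hasDerivAt s)).congr_deriv ?_
    rw [comp_apply, unitTangent, LinearIsometryEquiv.norm_map]
    rfl
  continuous_tangent := by
    have hd := planeToComplex.continuous.comp h.contDiff_deriv.continuous
    refine Continuous.comp ((hd.norm.inv₀ fun t => ?_).smul hd) R.continuous
    exact norm_ne_zero_iff.2 (planeToComplex.map_ne_zero_iff.2 (h.regular t))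
  norm_tangent s := by
    rw [comp_apply, unitTangent, norm_smul, norm_inv, norm_norm, inv_mul_cancel₀]
    rw [LinearIsometryEquiv.norm_map]
    exact norm_ne_zero_iff.2 (h.regular _)
  length_pos := hR.length_pos
  eq_iff s t := by
    rw [← hR.sub_mem_zmultiples_iff, ← h.apply_eq_apply_iff]
    exact planeToComplex.injective.eq_iff

theorem hasDerivAt_unitTangent (hR : IsArcLengthReparam γ L R ℓ) (h : IsSimpleClosed γ L) (s : ℝ) :
    HasDerivAt (unitTangent γ ∘ R)
      (curvature γ (R s) * Complex.I * unitTangent γ (R s)) s := by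
  have hg : HasDerivAt (fun t => planeToComplex (deriv γ t))
      (planeToComplex (deriv (deriv γ) (R s))) (R s) :=
    planeToComplex.toContinuousLinearEquiv.hasFDerivAt.comp_hasDerivAt (R s)
      (h.contDiff_deriv.differentiable (by norm_num) (R s)).hasDerivAt
  refine ((hasDerivAt_inv_norm_smul hg (planeToComplex.map_ne_zero_iff.2 (h.regular _))).scomp s
    (hR.hasDerivAt s)).congr_deriv ?_
  rw [← unitTangent]
  simp only [LinearIsometryEquiv.norm_map, planeToComplex_re, planeToComplex_im, curvature,
    Complex.real_smul]
  push_cast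
  ring

theorem hasDerivAt_curvature (hR : IsArcLengthReparam γ L R ℓ) (h : IsSimpleClosed γ L) (s : ℝ) :
    HasDerivAt (curvature γ ∘ R) (curvatureDot γ (R s)) s :=
  ((h.contDiff_curvature.differentiable (by norm_num) (R s)).hasDerivAt.comp s
    (hR.hasDerivAt s)).congr_deriv (div_eq_mul_inv _ _).symm

theorem eventually_curvatureDot_ne_zero (hR : IsArcLengthReparam γ L R ℓ) (h : IsSimpleClosed γ L)
    (hnd : IsNondegenerate γ) (s : ℝ) : ∀ᶠ u in 𝓝[≠] s, curvatureDot γ (R u) ≠ 0 :=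
  (hR.hasDerivAt s).tendsto_nhdsNE (inv_ne_zero (norm_ne_zero_iff.2 (h.regular _)))
    (h.eventually_curvatureDot_ne_zero hnd _)

end IsArcLengthReparam

/-! ### The coding of the signature by an induced word -/

theorem isCoding_of_letter_eq_iff {A X : Type*} [TopologicalSpace X] [T2Space X] {σ : ℝ → X}
    {Q : Set X} {C : ℤ → ℝ} {a : ℤ → A} (hσ : Continuous σ)
    (hloc : ∀ t t', σ t ∉ Q → σ t = σ t' → ∀ᶠ s in 𝓝 t, σ s = σ (s + (t' - t)))
    (hC : StrictMono C) (hrange : range C = σ ⁻¹' Q)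
    (hcover : ∀ x, ∃ i, x ∈ Icc (C i) (C (i + 1)))
    (hletter : ∀ i j, a i = a j ↔ σ (C i) = σ (C j) ∧ σ (C (i + 1)) = σ (C (j + 1)) ∧
      σ '' Ioo (C i) (C (i + 1)) = σ '' Ioo (C j) (C (j + 1))) :
    IsCoding σ Q C a where
  strictMono := hC
  range_eq := hrange
  exists_mem_Icc := hcover
  letter_eq_iff i j := by
    have hmem (i : ℤ) : σ (C i) ∈ Q := hrange.subset (mem_range_self i)
    have hgap (i : ℤ) : ∀ x ∈ Ioo (C i) (C (i + 1)), σ x ∉ Q := fun x hx hxQ => by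
      obtain ⟨n, rfl⟩ := hrange.superset hxQ
      have := hC.lt_iff_lt.1 hx.1
      have := hC.lt_iff_lt.1 hx.2
      omega
    rw [hletter]
    constructor
    · rintro ⟨-, -, himage⟩
      exact eq_shift_of_image_Ioo_eq hσ hloc (hC (lt_add_one i)) (hmem _) (hmem _) (hmem _)
        (hmem _) (hgap i) (hgap j) himage
    · rintro ⟨hlen, hshift⟩
      have hlt : C i ≤ C (i + 1) := (hC (lt_add_one i)).le
      have hleft : C i + (C j - C i) = C j := add_sub_cancel _ _
      have hright : C (i + 1) + (C j - C i) = C (j + 1) := by linarith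
      have hgaps : (· + (C j - C i)) '' Ioo (C i) (C (i + 1)) = Ioo (C j) (C (j + 1)) := by
        rw [image_add_const_Ioo, hleft, hright]
      refine ⟨?_, ?_, ?_⟩
      · rw [← hshift _ (left_mem_Icc.2 hlt), hleft]
      · rw [← hshift _ (right_mem_Icc.2 hlt), hright]
      · rw [← hgaps, image_image]
        exact image_congr fun x hx => (hshift x (Ioo_subset_Icc_self hx)).symm

section InducedWord

variable {γ : ℝ → Plane} {L : ℝ}

/-- The end points of an edge and the set of its points. They determine the edge, whose type
depends on its end points. -/
def edgeTrace {σ : ℝ → ℝ × ℝ} (e : QuiverEdge σ) : (ℝ × ℝ) × (ℝ × ℝ) × Set (ℝ × ℝ) :=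
  (e.left.1, e.right.1, e.hom.1)

theorem edgeTrace_injective {σ : ℝ → ℝ × ℝ} : Injective (edgeTrace (σ := σ)) := by
  rintro ⟨⟨l, hl⟩, ⟨r, hr⟩, ⟨E, hE⟩⟩ ⟨⟨l', hl'⟩, ⟨r', hr'⟩, ⟨E', hE'⟩⟩ h
  simp only [edgeTrace, Prod.mk.injEq] at h
  obtain ⟨rfl, rfl, rfl⟩ := h
  rfl

variable {W : List (QuiverEdge (sigMap γ))}

theorem InducesWord.length_ne_zero (hW : InducesWord γ L W) (hL : L ≠ 0) : W.length ≠ 0 := by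
  obtain ⟨c, -, hlast, -⟩ := hW
  intro hlen
  have h0 : Fin.last W.length = 0 := Fin.ext hlen
  rw [h0] at hlast
  exact hL (left_eq_add.1 hlast)

theorem InducesWord.exists_enumeration (hW : InducesWord γ L W) (h : IsSimpleClosed γ L) :
    ∃ C : ℤ → ℝ, StrictMono C ∧ (∀ i, C (i + W.length) = C i + L) ∧
      range C = sigMap γ ⁻¹' selfIntersections (range (sigMap γ)) ∧
      ∀ i, (cyclicLetter W i).map edgeTrace = some
        (sigMap γ (C i), sigMap γ (C (i + 1)), sigMap γ '' Ioo (C i) (C (i + 1))) := by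
  have hk := hW.length_ne_zero h.period_pos.ne'
  obtain ⟨c, hmono, hlast, hrange, hedge⟩ := hW
  refine ⟨quasiperiodicExtension c L, strictMono_quasiperiodicExtension hk hlast hmono,
    quasiperiodicExtension_add_length hk hlast,
    range_quasiperiodicExtension hk hlast h.period_pos
      (h.periodic_sigMap.comp (· ∈ selfIntersections (range (sigMap γ)))) hrange, fun i => ?_⟩
  obtain ⟨j, q, rfl⟩ := exists_eq_val_add_mul hk i
  have hσ : Periodic (sigMap γ) (q * L) := h.periodic_sigMap.int_mul q
  have hletter : cyclicLetter W (j + q * W.length) = some (W.get j) :=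
    ((periodic_cyclicLetter W).int_mul q j).trans
      ((cyclicLetter_natCast j.2).trans (List.getElem?_eq_getElem j.2))
  have htrace : edgeTrace (W.get j) = (sigMap γ (c j.castSucc), sigMap γ (c j.succ),
      sigMap γ '' Ioo (c j.castSucc) (c j.succ)) :=
    Prod.ext (hedge j).1 (Prod.ext (hedge j).2.1 (hedge j).2.2)
  rw [hletter, Option.map_some, htrace,
    quasiperiodicExtension_castSucc hk hlast, quasiperiodicExtension_succ hk hlast, hσ, hσ,
    ← image_add_const_Ioo, image_image]
  simp only [hσ _]

theorem IsArcLengthReparam.eventually_sigMap_eq_shift {ℓ : ℝ} {R : ℝ ≃o ℝ}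
    (hR : IsArcLengthReparam γ L R ℓ) (h : IsSimpleClosed γ L) (hnd : IsNondegenerate γ) {t t' : ℝ}
    (ht : sigMap γ (R t) ∉ selfIntersections (range (sigMap γ)))
    (htt' : sigMap γ (R t) = sigMap γ (R t')) :
    ∀ᶠ s in 𝓝 t, sigMap γ (R s) = sigMap γ (R (s + (t' - t))) := by
  refine IsSimplePoint.eventually_eq_shift (hR.hasDerivAt_curvature h)
    (h.continuous_curvatureDot.comp R.continuous) (hR.eventually_curvatureDot_ne_zero h hnd) ?_ htt'
  have hrange : range (fun s => (curvature γ (R s), curvatureDot γ (R s))) = range (sigMap γ) :=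
    R.surjective.range_comp (sigMap γ)
  by_contra hp
  exact ht ⟨mem_range_self _, hrange ▸ hp⟩

theorem InducesWord.exists_isCoding {ℓ : ℝ} {R : ℝ ≃o ℝ} (hW : InducesWord γ L W)
    (h : IsSimpleClosed γ L) (hnd : IsNondegenerate γ) (hR : IsArcLengthReparam γ L R ℓ) :
    ∃ C : ℤ → ℝ, C W.length - C 0 = ℓ ∧
      IsCoding (sigMap γ ∘ R) (selfIntersections (range (sigMap γ))) C (cyclicLetter W) := by
  obtain ⟨C, hmono, hadd, hrange, hedge⟩ := hW.exists_enumeration h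
  have hmono' : StrictMono (R.symm ∘ C) := R.symm.strictMono.comp hmono
  have hadd' (i : ℤ) : (R.symm ∘ C) (i + W.length) = (R.symm ∘ C) i + ℓ := by
    simp only [comp_apply]
    rw [R.symm_apply_eq, hR.apply_add_length, R.apply_symm_apply, hadd]
  have hval (i : ℤ) : (sigMap γ ∘ R) ((R.symm ∘ C) i) = sigMap γ (C i) := by
    simp only [comp_apply, R.apply_symm_apply]
  have himage (i : ℤ) : (sigMap γ ∘ R) '' Ioo ((R.symm ∘ C) i) ((R.symm ∘ C) (i + 1)) =
      sigMap γ '' Ioo (C i) (C (i + 1)) := by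
    rw [image_comp, R.image_Ioo, comp_apply, comp_apply, R.apply_symm_apply, R.apply_symm_apply]
  have hσ : Continuous (sigMap γ ∘ R) :=
    (h.contDiff_curvature.continuous.prodMk h.continuous_curvatureDot).comp R.continuous
  refine ⟨R.symm ∘ C, ?_, isCoding_of_letter_eq_iff hσ
    (fun _ _ => hR.eventually_sigMap_eq_shift h hnd) hmono' ?_
    (exists_mem_Icc_of_apply_add_eq hmono' hR.length_pos hadd') fun i j => ?_⟩
  · rw [← zero_add (W.length : ℤ), hadd', add_sub_cancel_left]
  · rw [range_comp, hrange]
    exact R.toEquiv.symm.image_eq_preimage_symm _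
  · rw [← (Option.map_injective edgeTrace_injective).eq_iff, hedge, hedge]
    simp only [himage, hval, Option.some.injEq, Prod.mk.injEq]

end InducedWord

theorem mainTheorem8 (γ : ℝ → Plane) (L : ℝ)
    (hγ : IsSimpleClosed γ L)
    (hnd : IsNondegenerate γ)
    (hfin : (selfIntersections (Set.range (sigMap γ))).Finite)
    (hne : (selfIntersections (Set.range (sigMap γ))).Nonempty)
    (w : List (QuiverEdge (sigMap γ))) (m : ℕ)
    (hW : InducesWord γ L (wordPow w m))
    (hw : ¬ IsPeriodicWord w) :
    symIndex (Set.range γ) = (m : ℕ∞) ∧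
    Nonempty (symGroup (Set.range γ) ≃* Multiplicative (ZMod m)) ∧
    ∃ C : Plane, ∀ g : SE2,
      g ∈ symGroup (Set.range γ) ↔
        ∃ k : ℕ, k < m ∧
          ∀ x : Plane, (g : Plane ≃ᵃⁱ[ℝ] Plane) x =
            rotationAbout C (2 * Real.pi * (k : ℝ) / (m : ℝ)) x := by
  have hm : m ≠ 0 :=
    left_ne_zero_of_mul (length_wordPow w m ▸ hW.length_ne_zero hγ.period_pos.ne')
  obtain ⟨R, ℓ, hR⟩ := hγ.exists_isArcLengthReparam
  obtain ⟨C, hℓ, hC⟩ := hW.exists_isCoding hγ hnd hR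
  rw [cyclicLetter_wordPow w hm] at hC
  have hP : m * (C w.length - C 0) = ℓ := by
    rw [← hℓ, length_wordPow]
    exact_mod_cast (hC.apply_mul_sub_of_periodic (periodic_cyclicLetter w) m).symm
  have hperiods (τ : ℝ) : Periodic (curvature γ ∘ R) τ ↔
      τ ∈ AddSubgroup.zmultiples (C w.length - C 0) := by
    rw [← hC.periodic_iff_mem_zmultiples hw,
      ← periodic_prodMk_deriv_iff (hR.hasDerivAt_curvature hγ)]
    rfl
  obtain ⟨ρ, hρ, hsym⟩ := (hR.isUnitSpeedClosed hγ).exists_symGroup_eq_zpowers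
    (hR.hasDerivAt_unitTangent hγ) hP hperiods
  rw [R.surjective.range_comp] at hsym
  rw [symIndex, hsym]
  refine ⟨by rw [enatCard_zpowers (hρ ▸ hm), hρ], ⟨mulEquivOfCyclicCardEq ?_⟩,
    SE2.mem_zpowers_iff_exists_rotationAbout hm hρ⟩
  rw [Nat.card_zpowers, hρ]
  exact (Nat.card_zmod m).symm
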